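/- Let $k$ be a field and let $H$ be a finite-dimensional weak Hopf algebra over $k$ which is semisimple as a ring. (A weak Hopf algebra is an algebra and coalgebra with $\Delta(gh)=\Delta(g)\Delta(h)$, $(\mathrm{id}\otimes\Delta)\Delta(1)=(\Delta(1)\otimes 1)(1\otimes\Delta(1))=(1\otimes\Delta(1))(\Delta(1)\otimes 1)$ and $\varepsilon(ghl)=\varepsilon(gh_1)\varepsilon(h_2l)=\varepsilon(gh_2)\varepsilon(h_1l)$, together with a linear antipode $S$ satisfying $S*\mathrm{id}=\varepsilon_s$, $\mathrm{id}*S=\varepsilon_t$ and $S*\mathrm{id}*S=S$, where $\varepsilon_t(h)=\varepsilon(1_1h)1_2$, $\varepsilon_s(h)=1_1\varepsilon(h1_2)$ and $H_t=\varepsilon_t(H)$.) Let $A$ be a right weak $H$-comodule algebra, that is, a $k$-algebra with a right $H$-comodule structure $\rho:A\to A\otimes H$, $a\mapsto a_0\otimes a_1$, such that $\rho(ab)=\rho(a)\rho(b)$ for all $a,b\in A$ and $\rho(1)\in A\otimes H_t$. Let $B=\{a\in A\mid \rho(a)=1_0a\otimes 1_1\}$ be its subalgebra of coinvariants, and suppose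 that * $B$ is finite-dimensional over $k$; * $A$ is faithfully flat as a right $B$-module; * $A/B$ is right weak $H$-Galois, i.e. the map $\beta:A\otimes_BA\to(A\otimes H)\rho(1)$, $a\otimes_Bb\mapsto ab_0\otimes b_1$, is bijective. For a ring $R$ put $\operatorname{fin.dim}R=\sup\{\operatorname{pd}_RM\mid M\text{ a finitely generated left }R\text{-module},\ \operatorname{pd}_RM<\infty\}$. If the finitistic dimension conjecture holds over $k$, i.e. $\operatorname{fin.dim}R<\infty$ for every finite-dimensional $k$-algebra $R$, then $$\operatorname{fin.dim}B=\operatorname{fin.dim}A.$$ -/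

import Mathlib

universe u v w w₁ w₂

open scoped TensorProduct

noncomputable section

namespace WeakHopf

open Coalgebra TensorProduct

/-! ### Weak bialgebras and weak Hopf algebras -/

/-- A weak bialgebra over a field `k`: an algebra and a coalgebra with multiplicative
comultiplication and weakened unit and counit axioms. -/
class WeakBialgebra (k : Type u) (H : Type w) [Field k] [Ring H] [Algebra k H] extends
    Coalgebra k H where
  /-- `Δ(gh) = Δ(g)Δ(h)` -/
  comul_mul (g h : H) : comul (g * h) = comul g * comul h
  /-- `Δ²(1) = 1₁ ⊗ 1₂1'₁ ⊗ 1'₂ = (Δ(1) ⊗ 1)(1 ⊗ Δ(1))` -/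
  comul_comul_one : comul.lTensor H (comul 1) =
    TensorProduct.assoc k H H H (comul 1 ⊗ₜ[k] (1 : H)) * ((1 : H) ⊗ₜ[k] comul (1 : H))
  /-- `Δ²(1) = 1₁ ⊗ 1'₁1₂ ⊗ 1'₂ = (1 ⊗ Δ(1))(Δ(1) ⊗ 1)` -/
  comul_comul_one' : comul.lTensor H (comul 1) =
    ((1 : H) ⊗ₜ[k] comul (1 : H)) * TensorProduct.assoc k H H H (comul 1 ⊗ₜ[k] (1 : H))
  /-- `ε(ghl) = ε(gh₁)ε(h₂l)` -/
  counit_mul_mul (g h l : H) : counit (g * h * l) =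
    LinearMap.mul' k k (TensorProduct.map (counit ∘ₗ LinearMap.mulLeft k g)
      (counit ∘ₗ LinearMap.mulRight k l) (comul h))
  /-- `ε(ghl) = ε(gh₂)ε(h₁l)` -/
  counit_mul_mul' (g h l : H) : counit (g * h * l) =
    LinearMap.mul' k k (TensorProduct.map (counit ∘ₗ LinearMap.mulRight k l)
      (counit ∘ₗ LinearMap.mulLeft k g) (comul h))

section Maps

variable (k : Type u) (H : Type w) [Field k] [Ring H] [Algebra k H] [Coalgebra k H]

/-- The target map `ε_t(h) = ε(1₁h)1₂`, obtained from `Δ(1)(h ⊗ 1)` by applying `ε ⊗ id`. -/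
def targetMap : H →ₗ[k] H :=
  (TensorProduct.lid k H).toLinearMap ∘ₗ counit.rTensor H ∘ₗ
    LinearMap.mulLeft k (comul (R := k) (1 : H)) ∘ₗ (TensorProduct.mk k H H).flip 1

/-- The source map `ε_s(h) = 1₁ε(h1₂)`, obtained from `(1 ⊗ h)Δ(1)` by applying `id ⊗ ε`. -/
def sourceMap : H →ₗ[k] H :=
  (TensorProduct.rid k H).toLinearMap ∘ₗ counit.lTensor H ∘ₗ
    LinearMap.mulRight k (comul (R := k) (1 : H)) ∘ₗ TensorProduct.mk k H H 1

/-- The target space `H_t = ε_t(H)`. -/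
def targetSpace : Submodule k H := LinearMap.range (targetMap k H)

variable {k H} in
/-- The convolution product `(f * g)(h) = f(h₁)g(h₂)`. -/
def conv (f g : H →ₗ[k] H) : H →ₗ[k] H :=
  LinearMap.mul' k H ∘ₗ TensorProduct.map f g ∘ₗ comul

end Maps

/-- A weak Hopf algebra: a weak bialgebra with an antipode. -/
class WeakHopfAlgebra (k : Type u) (H : Type w) [Field k] [Ring H] [Algebra k H] extends
    WeakBialgebra k H where
  /-- The antipode. -/
  antipode : H →ₗ[k] H
  /-- `S * id = ε_s` -/
  conv_antipode_id : conv antipode LinearMap.id = sourceMap k H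
  /-- `id * S = ε_t` -/
  conv_id_antipode : conv LinearMap.id antipode = targetMap k H
  /-- `S * id * S = S` -/
  conv_antipode_id_antipode : conv (conv antipode LinearMap.id) antipode = antipode

/-! ### Weak comodule algebras and coinvariants -/

/-- A right weak `H`-comodule algebra `A`. -/
class WeakComoduleAlgebra (k : Type u) (H : Type w) (A : Type v) [Field k] [Ring H] [Algebra k H]
    [WeakHopfAlgebra k H] [Ring A] [Algebra k A] where
  /-- The coaction `ρ(a) = a₀ ⊗ a₁`. -/
  coaction : A →ₗ[k] A ⊗[k] H
  coassoc (a : A) : TensorProduct.assoc k A H H (coaction.rTensor H (coaction a)) =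
    (comul (R := k) (A := H)).lTensor A (coaction a)
  counit_coaction (a : A) :
    TensorProduct.rid k A ((counit (R := k) (A := H)).lTensor A (coaction a)) = a
  coaction_mul (a b : A) : coaction (a * b) = coaction a * coaction b
  /-- `1₀ ⊗ 1₁ ∈ A ⊗ H_t` -/
  coaction_one_mem : coaction 1 ∈ LinearMap.range ((targetSpace k H).subtype.lTensor A)

section Coinvariants

variable (k : Type u) (H : Type w) (A : Type v) [Field k] [Ring H] [Algebra k H]
  [WeakHopfAlgebra k H] [Ring A] [Algebra k A] [WeakComoduleAlgebra k H A]

/-- The coaction `ρ : A → A ⊗ H`. -/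
abbrev rho : A →ₗ[k] A ⊗[k] H := WeakComoduleAlgebra.coaction

/-- The coinvariants `B = {a ∈ A | ρ(a) = 1₀a ⊗ 1₁}`. -/
def coinvariants : Subalgebra k A where
  carrier := {a | rho k H A a = rho k H A 1 * (a ⊗ₜ[k] (1 : H))}
  mul_mem' {a b} ha hb := by
    simp only [Set.mem_ofPred_eq] at ha hb ⊢
    have h1 : rho k H A a * rho k H A 1 = rho k H A a := by
      rw [← WeakComoduleAlgebra.coaction_mul, mul_one]
    rw [WeakComoduleAlgebra.coaction_mul, hb, ← mul_assoc, h1, ha, mul_assoc,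
      Algebra.TensorProduct.tmul_mul_tmul, one_mul]
  add_mem' {a b} ha hb := by
    simp only [Set.mem_ofPred_eq] at ha hb ⊢
    rw [map_add, ha, hb, add_tmul, mul_add]
  algebraMap_mem' r := by
    simp only [Set.mem_ofPred_eq, Algebra.algebraMap_eq_smul_one, map_smul]
    rw [← smul_tmul', ← Algebra.TensorProduct.one_def, mul_smul_comm, mul_one]

end Coinvariants

/-! ### The tensor product `A ⊗_B M` over a subalgebra `B`, and faithful flatness -/

section Balanced

variable {k : Type u} {A : Type v} [Field k] [Ring A] [Algebra k A] (B : Subalgebra k A)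

section Defs
variable (M : Type w₁) [AddCommGroup M] [Module B M]

/-- The subgroup of `A ⊗_ℤ M` generated by the elements `ab ⊗ m - a ⊗ bm` with `b ∈ B`. -/
def balancedRel : AddSubgroup (A ⊗[ℤ] M) :=
  AddSubgroup.closure {x | ∃ (a : A) (b : B) (m : M),
    x = (a * (b : A)) ⊗ₜ[ℤ] m - a ⊗ₜ[ℤ] (b • m)}

/-- The tensor product `A ⊗_B M` of the right `B`-module `A` and a left `B`-module `M`. -/
abbrev BalancedTensor : Type (max v w₁) := (A ⊗[ℤ] M) ⧸ balancedRel B M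

end Defs

variable {M : Type w₁} [AddCommGroup M] [Module B M] {N : Type w₂} [AddCommGroup N] [Module B N]

/-- The map `A ⊗_B f : A ⊗_B M → A ⊗_B N`. -/
def balancedMap (f : M →ₗ[B] N) : BalancedTensor B M →+ BalancedTensor B N :=
  QuotientAddGroup.map _ _ (f.toAddMonoidHom.toIntLinearMap.lTensor A).toAddMonoidHom <| by
    refine (AddSubgroup.closure_le _).2 ?_
    rintro _ ⟨a, b, m, rfl⟩
    refine AddSubgroup.subset_closure ⟨a, b, f m, ?_⟩
    rw [map_sub]
    exact congrArg (fun y => (a * (b : A)) ⊗ₜ[ℤ] f m - a ⊗ₜ[ℤ] y) (f.map_smul b m)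

/-- `A` is faithfully flat as a right `B`-module: a sequence of left `B`-modules is exact
if and only if it is exact after applying `A ⊗_B -`. -/
def IsRightFaithfullyFlat : Prop :=
  ∀ (L M N : Type v) [AddCommGroup L] [AddCommGroup M] [AddCommGroup N]
    [Module B L] [Module B M] [Module B N] (f : L →ₗ[B] M) (g : M →ₗ[B] N),
    Function.Exact f g ↔ Function.Exact (balancedMap B f) (balancedMap B g)

end Balanced

/-! ### The Galois map -/

lemma biadditive_zsmul {X Y Z : Type*} [AddCommGroup X] [AddCommGroup Y] [AddCommGroup Z]
    (f : X →+ Y →+ Z) (n : ℤ) (x : X) (y : Y) : f (n • x) y = f x (n • y) := by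
  rw [map_zsmul, map_zsmul, AddMonoidHom.coe_smul, Pi.smul_apply]

lemma assoc_mul {k : Type u} {H : Type w} {A : Type v} [Field k] [Ring H] [Algebra k H]
    [Ring A] [Algebra k A] (x y : (A ⊗[k] H) ⊗[k] H) :
    TensorProduct.assoc k A H H (x * y) =
      TensorProduct.assoc k A H H x * TensorProduct.assoc k A H H y :=
  map_mul (Algebra.TensorProduct.assoc k k k A H H) x y

section Galois

variable {k : Type u} {H : Type w} {A : Type v} [Field k] [Ring H] [Algebra k H]
  [WeakHopfAlgebra k H] [Ring A] [Algebra k A]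

/-- For `z ∈ H_t`: `Δ(z) = z1₁ ⊗ 1₂`. -/
lemma comul_of_mem_targetSpace {z : H} (hz : z ∈ targetSpace k H) :
    comul (R := k) z = (z ⊗ₜ[k] (1 : H)) * comul 1 := by
  obtain ⟨h, rfl⟩ := hz
  have e1 : ∀ x : H ⊗[k] H, comul (R := k) (TensorProduct.lid k H (counit.rTensor H x)) =
      TensorProduct.lid k (H ⊗[k] H) ((counit (R := k) (A := H)).rTensor (H ⊗[k] H)
        (comul.lTensor H x)) := by
    intro x
    induction x with
    | zero => simp
    | tmul x y => simp
    | add x y hx hy => simp only [map_add, hx, hy]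
  have e2 : ∀ x : H ⊗[k] H, (comul (R := k) (A := H)).lTensor H (x * (h ⊗ₜ[k] (1 : H))) =
      comul.lTensor H x * (h ⊗ₜ[k] (1 : H ⊗[k] H)) := by
    intro x
    induction x with
    | zero => simp
    | tmul x y => simp [Algebra.TensorProduct.tmul_mul_tmul]
    | add x y hx hy => simp only [map_add, add_mul, hx, hy]
  have e3 : ∀ (x : H ⊗[k] H) (c : H ⊗[k] H),
      TensorProduct.lid k (H ⊗[k] H) ((counit (R := k) (A := H)).rTensor (H ⊗[k] H)
        (TensorProduct.assoc k H H H (x ⊗ₜ[k] (1 : H)) * ((1 : H) ⊗ₜ[k] c) *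
          (h ⊗ₜ[k] (1 : H ⊗[k] H)))) =
      (TensorProduct.lid k H (counit.rTensor H (x * (h ⊗ₜ[k] (1 : H)))) ⊗ₜ[k] (1 : H)) * c := by
    intro x c
    induction x with
    | zero => simp
    | tmul x y => simp only [TensorProduct.assoc_tmul, Algebra.TensorProduct.tmul_mul_tmul, mul_one,
        LinearMap.rTensor_tmul, TensorProduct.lid_tmul, ← TensorProduct.smul_tmul',
        smul_mul_assoc]
    | add x y hx hy => simp only [map_add, add_tmul, add_mul, hx, hy]
  change comul (R := k) (TensorProduct.lid k H (counit.rTensor H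
    (comul 1 * (h ⊗ₜ[k] (1 : H))))) = (TensorProduct.lid k H (counit.rTensor H
    (comul 1 * (h ⊗ₜ[k] (1 : H)))) ⊗ₜ[k] (1 : H)) * comul 1
  rw [e1, e2, WeakBialgebra.comul_comul_one, e3]

/-- For `x ∈ A ⊗ H_t`: `(id ⊗ Δ)(x) = (x ⊗ 1)(1 ⊗ Δ(1))`. -/
lemma lTensor_comul_of_mem {x : A ⊗[k] H}
    (hx : x ∈ LinearMap.range ((targetSpace k H).subtype.lTensor A)) :
    (comul (R := k) (A := H)).lTensor A x =
      TensorProduct.assoc k A H H (x ⊗ₜ[k] (1 : H)) * ((1 : A) ⊗ₜ[k] comul (1 : H)) := by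
  obtain ⟨y, rfl⟩ := hx
  induction y with
  | zero => simp
  | tmul a z => simp [Algebra.TensorProduct.tmul_mul_tmul, comul_of_mem_targetSpace z.2]
  | add x y hx hy => simp only [map_add, add_tmul, add_mul, hx, hy]

variable [WeakComoduleAlgebra k H A]

/-- For a coinvariant `b`: `ρ(b) = b1₀ ⊗ 1₁`. -/
lemma rho_of_mem_coinvariants {b : A} (hb : b ∈ coinvariants k H A) :
    rho k H A b = (b ⊗ₜ[k] (1 : H)) * rho k H A 1 := by
  have hb' : rho k H A b = rho k H A 1 * (b ⊗ₜ[k] (1 : H)) := hb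
  have hmem : rho k H A b ∈ LinearMap.range ((targetSpace k H).subtype.lTensor A) := by
    rw [hb']
    obtain ⟨y, hy⟩ := WeakComoduleAlgebra.coaction_one_mem (k := k) (H := H) (A := A)
    rw [← hy]
    clear hy
    induction y with
    | zero => simp
    | tmul a z => exact ⟨(a * b) ⊗ₜ z, by simp [Algebra.TensorProduct.tmul_mul_tmul]⟩
    | add x y hx hy => rw [map_add, add_mul]; exact add_mem hx hy
  let F : A ⊗[k] (H ⊗[k] H) →ₗ[k] A ⊗[k] H :=
    ((TensorProduct.lid k H).toLinearMap ∘ₗ counit.rTensor H).lTensor A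
  have f1 : ∀ x : A ⊗[k] H, F ((comul (R := k) (A := H)).lTensor A x) = x := by
    intro x
    induction x with
    | zero => simp
    | tmul a h => simp [F]
    | add x y hx hy => simp only [map_add, hx, hy]
  have f2 : ∀ (z : A ⊗[k] H) (h : H), F (TensorProduct.assoc k A H H (z ⊗ₜ[k] h)) =
      (TensorProduct.rid k A ((counit (R := k) (A := H)).lTensor A z)) ⊗ₜ[k] h := by
    intro z h
    induction z with
    | zero => simp
    | tmul a g => simp [F, TensorProduct.smul_tmul]
    | add x y hx hy => simp only [map_add, add_tmul, hx, hy]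
  have f3 : ∀ x : A ⊗[k] H, F (TensorProduct.assoc k A H H ((rho k H A).rTensor H x)) = x := by
    intro x
    induction x with
    | zero => simp
    | tmul a h => rw [LinearMap.rTensor_tmul, f2, WeakComoduleAlgebra.counit_coaction]
    | add x y hx hy => simp only [map_add, hx, hy]
  have f4 : ∀ x : A ⊗[k] H, (rho k H A).rTensor H ((b ⊗ₜ[k] (1 : H)) * x) =
      (rho k H A b ⊗ₜ[k] (1 : H)) * (rho k H A).rTensor H x := by
    intro x
    induction x with
    | zero => simp
    | tmul a h =>
      simp [Algebra.TensorProduct.tmul_mul_tmul, WeakComoduleAlgebra.coaction_mul]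
    | add x y hx hy => simp only [map_add, mul_add, hx, hy]
  have h1 : rho k H A b * rho k H A 1 = rho k H A b := by
    rw [← WeakComoduleAlgebra.coaction_mul, mul_one]
  rw [← f3 ((b ⊗ₜ[k] (1 : H)) * rho k H A 1), f4, assoc_mul, WeakComoduleAlgebra.coassoc,
    lTensor_comul_of_mem WeakComoduleAlgebra.coaction_one_mem, ← mul_assoc, ← assoc_mul,
    Algebra.TensorProduct.tmul_mul_tmul, h1, mul_one, ← lTensor_comul_of_mem hmem, f1]

variable (k H A)

/-- The subspace `A ⊗_t H = (A ⊗ H)ρ(1)` of `A ⊗ H`. -/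
def tensorTarget : Submodule k (A ⊗[k] H) :=
  LinearMap.range (LinearMap.mulRight k (rho k H A 1))

/-- The biadditive map `(a, b) ↦ ab₀ ⊗ b₁ = (a ⊗ 1)ρ(b)` with values in `A ⊗_t H`. -/
def galoisPair : A →+ A →+ tensorTarget k H A :=
  AddMonoidHom.mk' (fun a => AddMonoidHom.mk'
    (fun b => (⟨(a ⊗ₜ[k] (1 : H)) * rho k H A b, (a ⊗ₜ[k] (1 : H)) * rho k H A b, by
      rw [LinearMap.mulRight_apply, mul_assoc, ← WeakComoduleAlgebra.coaction_mul,
        mul_one]⟩ : tensorTarget k H A))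
    (fun b b' => Subtype.ext (by simp [mul_add])))
    (fun a a' => AddMonoidHom.ext fun b => Subtype.ext (by simp [add_tmul, add_mul]))

/-- The map `A ⊗_ℤ A → A ⊗_t H`, `a ⊗ b ↦ ab₀ ⊗ b₁`. -/
def galoisAux : A ⊗[ℤ] A →+ tensorTarget k H A :=
  TensorProduct.liftAddHom (galoisPair k H A) (biadditive_zsmul (galoisPair k H A))

/-- The Galois map `β : A ⊗_B A → A ⊗_t H`, `a ⊗_B b ↦ ab₀ ⊗_t b₁`, where `B` is the algebra
of coinvariants of `A`. -/
def galoisMap : BalancedTensor (coinvariants k H A) A →+ tensorTarget k H A :=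
  QuotientAddGroup.lift (balancedRel (coinvariants k H A) A) (galoisAux k H A) <| by
    refine (AddSubgroup.closure_le _).2 ?_
    rintro _ ⟨a, b, m, rfl⟩
    rw [SetLike.mem_coe, AddMonoidHom.mem_ker, map_sub, sub_eq_zero]
    refine Subtype.ext ?_
    change ((a * (b : A)) ⊗ₜ[k] (1 : H)) * rho k H A m =
      (a ⊗ₜ[k] (1 : H)) * rho k H A ((b : A) * m)
    rw [WeakComoduleAlgebra.coaction_mul, rho_of_mem_coinvariants b.2, mul_assoc,
      ← WeakComoduleAlgebra.coaction_mul 1 m, one_mul, ← mul_assoc,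
      Algebra.TensorProduct.tmul_mul_tmul, one_mul]

/-- The extension `A/B`, with `B` the coinvariants of `A`, is right weak `H`-Galois. -/
def IsWeakGalois : Prop := Function.Bijective (galoisMap k H A)

end Galois

/-! ### Finitistic dimension -/

/-- The finitistic dimension of a ring `R`: the supremum of the projective dimensions of the
finitely generated left `R`-modules of finite projective dimension. The zero module has
projective dimension `⊥`. -/
def finDim (R : Type v) [Ring R] : WithBot ℕ∞ :=
  ⨆ (M : ModuleCat.{v} R) (_ : Module.Finite R M)
    (_ : CategoryTheory.projectiveDimension M < ⊤), CategoryTheory.projectiveDimension M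

/-- The finitistic dimension conjecture over the field `k`: every finite-dimensional
`k`-algebra has finite finitistic dimension. -/
def FinitisticDimensionConjecture (k : Type u) [Field k] : Prop :=
  ∀ (R : Type v) [Ring R] [Algebra k R], FiniteDimensional k R → finDim R < ⊤

end WeakHopf

end

/-! Two facts about the extension carry the theorem. First, `A` is finitely generated projective as
a left `B`-module (`IsWeakGalois.exists_dual_basis`). Second, `A/B` is separable
(`IsWeakGalois.exists_separability`). Together they show that an `A`-module is projective over `B`
if and only if it is projective over `A`, so restriction to `B` preserves projective dimension
(`projectiveDimension_restrict`). It also preserves finite generation, which gives fin.dim `A` ≤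
fin.dim `B`.

For the other inequality let fin.dim `B` = n, finite by the conjecture and attained by M, and
suppose fin.dim `A` < n. By flatness `N = A ⊗_B M` has finite projective dimension over `A`, hence
dimension less than n over `A` and over `B`. By faithful flatness M embeds in N over `B`. The
cokernel C is finitely generated of finite projective dimension over `B`, hence of dimension at most
n. The sequence 0 → M → N → C → 0 then forces pd M < n, a contradiction.

The dual basis comes from integrals λ on `H`, that is, functionals with h₁λ(h₂) ∈ `H_t`. Each gives
a left `B`-linear map a ↦ a₀λ(a₁) from `A` to `B`. If β(∑ x ⊗ y) = 1₀ ⊗ g1₁, then ∑ (ax)₀λ((ax)₁)y =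
a₀λ(a₁S(g)). An explicit trace formula (`traceIntegral`) yields integrals λᵢ with ∑ λᵢ(hS(eᵢ)) =
ε(h) for a basis eᵢ of `H`, so summing over g = eᵢ returns a. This formula rests on the antipode
reversing products and coproducts.

For separability, semisimplicity of `H` splits the right ideal ker ε_s off and so provides a right
integral t with ε_s(t) = 1. The preimage of 1₀ ⊗ t1₁ under β is a separability element. -/

namespace WeakHopf

open Coalgebra TensorProduct WithConv

/-! ### Source and target maps of a weak bialgebra -/

section Identities

variable {k : Type u} {H : Type w} [Field k] [Ring H] [Algebra k H]

section WeakBialgebra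

variable [WeakBialgebra k H]

lemma targetMap_apply (h : H) : targetMap k H h =
    TensorProduct.lid k H (counit.rTensor H (comul (R := k) (1 : H) * (h ⊗ₜ[k] (1 : H)))) := rfl

lemma sourceMap_apply (h : H) : sourceMap k H h =
    TensorProduct.rid k H (counit.lTensor H (((1 : H) ⊗ₜ[k] h) * comul (R := k) (1 : H))) := rfl

/-- `ε(gl) = ε(g1₁)ε(1₂l)` for any expression of `Δ(1)`. -/
lemma counit_mul_sum {g l : H} (s : Finset (H × H))
    (hs : comul (R := k) (1 : H) = ∑ i ∈ s, i.1 ⊗ₜ i.2) :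
    counit (R := k) (g * l) =
      ∑ i ∈ s, counit (R := k) (g * i.1) * counit (R := k) (i.2 * l) := by
  have := WeakBialgebra.counit_mul_mul (k := k) g 1 l
  rw [mul_one, hs] at this
  simpa using this

/-- `ε(gl) = ε(g1₂)ε(1₁l)` for any expression of `Δ(1)`. -/
lemma counit_mul_sum' {g l : H} (s : Finset (H × H))
    (hs : comul (R := k) (1 : H) = ∑ i ∈ s, i.1 ⊗ₜ i.2) :
    counit (R := k) (g * l) =
      ∑ i ∈ s, counit (R := k) (g * i.2) * counit (R := k) (i.1 * l) := by
  have := WeakBialgebra.counit_mul_mul' (k := k) g 1 l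
  rw [mul_one, hs] at this
  simpa [mul_comm] using this

lemma targetMap_eq_sum (s : Finset (H × H))
    (hs : comul (R := k) (1 : H) = ∑ i ∈ s, i.1 ⊗ₜ i.2) (h : H) :
    targetMap k H h = ∑ i ∈ s, counit (R := k) (i.1 * h) • i.2 := by
  simp [targetMap_apply, hs, Finset.sum_mul]

lemma sourceMap_eq_sum (s : Finset (H × H))
    (hs : comul (R := k) (1 : H) = ∑ i ∈ s, i.1 ⊗ₜ i.2) (h : H) :
    sourceMap k H h = ∑ i ∈ s, counit (R := k) (h * i.2) • i.1 := by
  simp [sourceMap_apply, hs, Finset.mul_sum]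

variable (k) in
lemma exists_comul_one : ∃ s : Finset (H × H),
    comul (R := k) (1 : H) = ∑ i ∈ s, i.1 ⊗ₜ i.2 :=
  TensorProduct.exists_finset _

lemma targetMap_mul_targetMap (g h : H) :
    targetMap k H (g * targetMap k H h) = targetMap k H (g * h) := by
  obtain ⟨s, hs⟩ := exists_comul_one k (H := H)
  simp only [targetMap_eq_sum s hs]
  refine Finset.sum_congr rfl fun i _ => ?_
  rw [← mul_assoc i.1 g h, counit_mul_sum' s hs (g := i.1 * g) (l := h)]
  simp [Finset.mul_sum, mul_assoc, mul_comm]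

lemma sourceMap_sourceMap_mul (g h : H) :
    sourceMap k H (sourceMap k H g * h) = sourceMap k H (g * h) := by
  obtain ⟨s, hs⟩ := exists_comul_one k (H := H)
  simp only [sourceMap_eq_sum s hs]
  refine Finset.sum_congr rfl fun i _ => ?_
  rw [mul_assoc g h, counit_mul_sum' s hs (g := g) (l := h * i.2)]
  simp [Finset.sum_mul, mul_assoc]

@[simp] lemma sourceMap_one : sourceMap k H 1 = 1 := by
  rw [sourceMap_apply, ← Algebra.TensorProduct.one_def, one_mul, lTensor_counit_comul]
  simp

lemma targetMap_targetMap (h : H) : targetMap k H (targetMap k H h) = targetMap k H h := by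
  simpa using targetMap_mul_targetMap (k := k) 1 h

lemma sourceMap_sourceMap (h : H) : sourceMap k H (sourceMap k H h) = sourceMap k H h := by
  simpa using sourceMap_sourceMap_mul (k := k) h 1

lemma targetMap_of_mem {z : H} (hz : z ∈ targetSpace k H) : targetMap k H z = z := by
  obtain ⟨h, rfl⟩ := hz
  exact targetMap_targetMap h

/-- `Δ²(1) = 1₁ ⊗ 1₂1'₁ ⊗ 1'₂` for any expression of `Δ(1)`. -/
lemma lTensor_comul_one (s : Finset (H × H))
    (hs : comul (R := k) (1 : H) = ∑ i ∈ s, i.1 ⊗ₜ i.2) :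
    ∑ i ∈ s, i.1 ⊗ₜ[k] comul (R := k) i.2 =
      ∑ i ∈ s, ∑ j ∈ s, i.1 ⊗ₜ[k] ((i.2 * j.1) ⊗ₜ[k] j.2) := by
  have := WeakBialgebra.comul_comul_one (k := k) (H := H)
  rw [hs] at this
  simpa [sum_tmul, tmul_sum, Finset.sum_mul_sum] using this

/-- `Δ²(1) = 1₁ ⊗ 1'₁1₂ ⊗ 1'₂` for any expression of `Δ(1)`. -/
lemma lTensor_comul_one' (s : Finset (H × H))
    (hs : comul (R := k) (1 : H) = ∑ i ∈ s, i.1 ⊗ₜ i.2) :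
    ∑ i ∈ s, i.1 ⊗ₜ[k] comul (R := k) i.2 =
      ∑ i ∈ s, ∑ j ∈ s, i.1 ⊗ₜ[k] ((j.1 * i.2) ⊗ₜ[k] j.2) := by
  have := WeakBialgebra.comul_comul_one' (k := k) (H := H)
  rw [hs] at this
  rw [Finset.sum_comm]
  simpa [sum_tmul, tmul_sum, Finset.sum_mul_sum] using this

lemma rTensor_comul_one_eq (s : Finset (H × H))
    (hs : comul (R := k) (1 : H) = ∑ i ∈ s, i.1 ⊗ₜ i.2) :
    ∑ i ∈ s, comul (R := k) i.1 ⊗ₜ[k] i.2 = (TensorProduct.assoc k H H H).symm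
      (∑ i ∈ s, i.1 ⊗ₜ[k] comul (R := k) i.2) := by
  have := coassoc_apply (R := k) (1 : H)
  rw [hs] at this
  rw [LinearEquiv.eq_symm_apply]
  simpa using this

/-- `Δ²(1) = 1₁ ⊗ 1₂1'₁ ⊗ 1'₂` for any expression of `Δ(1)`. -/
lemma rTensor_comul_one (s : Finset (H × H))
    (hs : comul (R := k) (1 : H) = ∑ i ∈ s, i.1 ⊗ₜ i.2) :
    ∑ i ∈ s, comul (R := k) i.1 ⊗ₜ[k] i.2 =
      ∑ i ∈ s, ∑ j ∈ s, (i.1 ⊗ₜ[k] (i.2 * j.1)) ⊗ₜ[k] j.2 := by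
  rw [rTensor_comul_one_eq s hs, lTensor_comul_one s hs]
  simp

/-- `Δ²(1) = 1₁ ⊗ 1'₁1₂ ⊗ 1'₂` for any expression of `Δ(1)`. -/
lemma rTensor_comul_one' (s : Finset (H × H))
    (hs : comul (R := k) (1 : H) = ∑ i ∈ s, i.1 ⊗ₜ i.2) :
    ∑ i ∈ s, comul (R := k) i.1 ⊗ₜ[k] i.2 =
      ∑ i ∈ s, ∑ j ∈ s, (i.1 ⊗ₜ[k] (j.1 * i.2)) ⊗ₜ[k] j.2 := by
  rw [rTensor_comul_one_eq s hs, lTensor_comul_one' s hs]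
  simp

/-- The elements of `ε_t(H)` and `ε_s(H)` commute. -/
lemma targetMap_mul_sourceMap (g h : H) :
    targetMap k H g * sourceMap k H h = sourceMap k H h * targetMap k H g := by
  obtain ⟨s, hs⟩ := exists_comul_one k (H := H)
  -- The two forms of Δ²(1) differ only in the order of the middle product. Applying ε(·g) to the
  -- first leg and ε(h·) to the third turns that product into ε_t(g)ε_s(h) in one form and
  -- ε_s(h)ε_t(g) in the other.
  have key := (lTensor_comul_one s hs).symm.trans (lTensor_comul_one' s hs)
  have := congrArg (TensorProduct.lift (LinearMap.lsmul k H ∘ₗ (counit (R := k) (A := H) ∘ₗ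
    LinearMap.mulRight k g)) ∘ₗ LinearMap.lTensor H ((TensorProduct.rid k H).toLinearMap ∘ₗ
      LinearMap.lTensor H (counit (R := k) (A := H) ∘ₗ LinearMap.mulLeft k h))) key
  simp only [map_sum] at this
  simp only [LinearMap.comp_apply, LinearMap.lTensor_tmul, LinearEquiv.coe_coe,
    TensorProduct.rid_tmul, TensorProduct.lift.tmul, LinearMap.mulRight_apply,
    LinearMap.mulLeft_apply, LinearMap.lsmul_apply] at this
  rw [targetMap_eq_sum s hs, sourceMap_eq_sum s hs, Finset.sum_mul_sum, Finset.sum_mul_sum,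
    Finset.sum_comm (s := s) (t := s) (f := fun i j => (counit (R := k) (h * i.2) • i.1) *
      (counit (R := k) (j.1 * g) • j.2))]
  simpa [smul_smul, mul_comm] using this

/-- For `z ∈ H_t`: `Δ(z) = 1₁z ⊗ 1₂`. -/
lemma comul_targetMap (h : H) : comul (R := k) (targetMap k H h) =
    comul 1 * (targetMap k H h ⊗ₜ[k] (1 : H)) := by
  obtain ⟨s, hs⟩ := exists_comul_one k (H := H)
  have := congrArg (TensorProduct.lift (LinearMap.lsmul k (H ⊗[k] H) ∘ₗ
    (counit (R := k) (A := H) ∘ₗ LinearMap.mulRight k h))) (lTensor_comul_one' s hs)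
  simp only [map_sum, TensorProduct.lift.tmul, LinearMap.comp_apply, LinearMap.lsmul_apply,
    LinearMap.mulRight_apply] at this
  rw [targetMap_eq_sum s hs, map_sum]
  simp only [map_smul]
  rw [this, hs, sum_tmul, Finset.sum_mul_sum, Finset.sum_comm]
  simp [smul_tmul']

/-- For `z ∈ H_s`: `Δ(z) = 1₁ ⊗ 1₂z`. -/
lemma comul_sourceMap (h : H) : comul (R := k) (sourceMap k H h) =
    comul 1 * ((1 : H) ⊗ₜ[k] sourceMap k H h) := by
  obtain ⟨s, hs⟩ := exists_comul_one k (H := H)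
  have := congrArg ((TensorProduct.rid k (H ⊗[k] H)).toLinearMap ∘ₗ LinearMap.lTensor (H ⊗[k] H)
    (counit (R := k) (A := H) ∘ₗ LinearMap.mulLeft k h)) (rTensor_comul_one s hs)
  simp only [map_sum, LinearMap.comp_apply, LinearMap.lTensor_tmul, LinearEquiv.coe_coe,
    TensorProduct.rid_tmul, LinearMap.mulLeft_apply] at this
  rw [sourceMap_eq_sum s hs, map_sum]
  simp only [map_smul]
  rw [this, hs, tmul_sum, Finset.sum_mul_sum]
  simp

/-- For `z ∈ H_s`: `Δ(z) = 1₁ ⊗ z1₂`. -/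
lemma comul_sourceMap' (h : H) : comul (R := k) (sourceMap k H h) =
    ((1 : H) ⊗ₜ[k] sourceMap k H h) * comul 1 := by
  obtain ⟨s, hs⟩ := exists_comul_one k (H := H)
  have := congrArg ((TensorProduct.rid k (H ⊗[k] H)).toLinearMap ∘ₗ LinearMap.lTensor (H ⊗[k] H)
    (counit (R := k) (A := H) ∘ₗ LinearMap.mulLeft k h)) (rTensor_comul_one' s hs)
  simp only [map_sum, LinearMap.comp_apply, LinearMap.lTensor_tmul, LinearEquiv.coe_coe,
    TensorProduct.rid_tmul, LinearMap.mulLeft_apply] at this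
  rw [sourceMap_eq_sum s hs, map_sum]
  simp only [map_smul]
  rw [this, hs, tmul_sum, Finset.sum_mul_sum, Finset.sum_comm]
  simp

/-- `h₁ ⊗ ε_t(h₂) = 1₁h ⊗ 1₂`. -/
lemma lTensor_targetMap_comul (h : H) : (targetMap k H).lTensor H (comul (R := k) h) =
    comul 1 * (h ⊗ₜ[k] (1 : H)) := by
  obtain ⟨s, hs⟩ := exists_comul_one k (H := H)
  let F : (H ⊗[k] H) ⊗[k] H →ₗ[k] H ⊗[k] H :=
    ((TensorProduct.rid k H).toLinearMap ∘ₗ (counit (R := k) (A := H)).lTensor H).rTensor H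
  have F_comul : ∀ x y : H, F (comul (R := k) x ⊗ₜ[k] y) = x ⊗ₜ y := fun x y => by simp [F]
  have F_mul : ∀ x : H ⊗[k] H, F (∑ j ∈ s, (((1 : H) ⊗ₜ[k] j.1) * x) ⊗ₜ[k] j.2) =
      (targetMap k H).lTensor H x := by
    intro x
    induction x with
    | zero => simp
    | tmul x y => simp [F, targetMap_eq_sum s hs, tmul_sum, smul_tmul]
    | add x y hx hy => simp only [mul_add, add_tmul, Finset.sum_add_distrib, map_add, hx, hy]
  -- Multiply Δ²(1) = 1₁ ⊗ 1'₁1₂ ⊗ 1'₂ by Δ(h) ⊗ 1 and apply ε in the middle. The left side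
  -- collapses to 1₁h ⊗ 1₂. On the right Δ(1) is absorbed by Δ(h), and the remaining 1'₁, 1'₂ build
  -- ε_t(h₂).
  have key := congrArg (fun x => F (x * (comul (R := k) h ⊗ₜ[k] (1 : H))))
    (rTensor_comul_one' s hs)
  simp only [Finset.sum_mul, Algebra.TensorProduct.tmul_mul_tmul, mul_one,
    ← WeakBialgebra.comul_mul, map_sum, F_comul] at key
  rw [hs, Finset.sum_mul]
  simp only [Algebra.TensorProduct.tmul_mul_tmul, mul_one]
  rw [key, ← F_mul, Finset.sum_comm, map_sum]
  refine Finset.sum_congr rfl fun j _ => ?_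
  rw [← map_sum, ← sum_tmul]
  have : ∀ i : H × H, i.1 ⊗ₜ[k] (j.1 * i.2) = ((1 : H) ⊗ₜ[k] j.1) * (i.1 ⊗ₜ[k] i.2) := by simp
  simp only [this]
  simp only [mul_assoc]
  rw [← Finset.mul_sum, ← Finset.sum_mul, ← hs, ← WeakBialgebra.comul_mul, one_mul]

/-- `ε_s(h₁) ⊗ h₂ = 1₁ ⊗ h1₂`. -/
lemma rTensor_sourceMap_comul (h : H) : (sourceMap k H).rTensor H (comul (R := k) h) =
    ((1 : H) ⊗ₜ[k] h) * comul 1 := by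
  obtain ⟨s, hs⟩ := exists_comul_one k (H := H)
  let F : H ⊗[k] (H ⊗[k] H) →ₗ[k] H ⊗[k] H :=
    ((TensorProduct.lid k H).toLinearMap ∘ₗ (counit (R := k) (A := H)).rTensor H).lTensor H
  have F_comul : ∀ x y : H, F (x ⊗ₜ[k] comul (R := k) y) = x ⊗ₜ y := fun x y => by simp [F]
  have F_mul : ∀ x : H ⊗[k] H, F (∑ i ∈ s, i.1 ⊗ₜ[k] (x * (i.2 ⊗ₜ[k] (1 : H)))) =
      (sourceMap k H).rTensor H x := by
    intro x
    induction x with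
    | zero => simp
    | tmul x y => simp [F, sourceMap_eq_sum s hs, sum_tmul, smul_tmul]
    | add x y hx hy => simp only [add_mul, tmul_add, Finset.sum_add_distrib, map_add, hx, hy]
  have key := congrArg (fun x => F (((1 : H) ⊗ₜ[k] comul (R := k) h) * x))
    (lTensor_comul_one' s hs)
  simp only [Finset.mul_sum, Algebra.TensorProduct.tmul_mul_tmul, one_mul,
    ← WeakBialgebra.comul_mul, map_sum, F_comul] at key
  rw [hs, Finset.mul_sum]
  simp only [Algebra.TensorProduct.tmul_mul_tmul, one_mul]
  rw [key, ← F_mul, map_sum]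
  refine Finset.sum_congr rfl fun i _ => ?_
  rw [← map_sum, ← tmul_sum]
  have : ∀ j : H × H, (j.1 * i.2) ⊗ₜ[k] j.2 = (j.1 ⊗ₜ[k] j.2) * (i.2 ⊗ₜ[k] (1 : H)) := by simp
  simp only [this]
  rw [← Finset.mul_sum, ← Finset.sum_mul, ← hs, ← mul_assoc, ← WeakBialgebra.comul_mul, mul_one]

/-- `ε_s(h₁) ⊗ ε_t(h₂) = ε_s(h₂) ⊗ ε_t(h₁)`. -/
lemma map_sourceMap_targetMap_comul (h : H) :
    TensorProduct.map (sourceMap k H) (targetMap k H) (comul (R := k) h) =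
      TensorProduct.comm k H H
        (TensorProduct.map (targetMap k H) (sourceMap k H) (comul (R := k) h)) := by
  obtain ⟨s, hs⟩ := exists_comul_one k (H := H)
  have h₁ : ∀ x : H ⊗[k] H, TensorProduct.map (sourceMap k H) (targetMap k H) x =
      ∑ i ∈ s, ∑ j ∈ s, LinearMap.mul' k k (TensorProduct.map (counit ∘ₗ LinearMap.mulRight k i.2)
        (counit ∘ₗ LinearMap.mulLeft k j.1) x) • i.1 ⊗ₜ[k] j.2 := by
    intro x
    induction x with
    | zero => simp
    | tmul x y =>
      simp only [TensorProduct.map_tmul, targetMap_eq_sum s hs, sourceMap_eq_sum s hs, sum_tmul,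
        tmul_sum, smul_tmul_smul]
      rw [Finset.sum_comm]
      simp
    | add x y hx hy => simp only [map_add, add_smul, Finset.sum_add_distrib, hx, hy]
  have h₂ : ∀ x : H ⊗[k] H, TensorProduct.comm k H H
        (TensorProduct.map (targetMap k H) (sourceMap k H) x) =
      ∑ i ∈ s, ∑ j ∈ s, LinearMap.mul' k k (TensorProduct.map (counit ∘ₗ LinearMap.mulLeft k j.1)
        (counit ∘ₗ LinearMap.mulRight k i.2) x) • i.1 ⊗ₜ[k] j.2 := by
    intro x
    induction x with
    | zero => simp
    | tmul x y =>
      simp only [TensorProduct.map_tmul, targetMap_eq_sum s hs, sourceMap_eq_sum s hs,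
        sum_tmul, tmul_sum, smul_tmul_smul]
      simp [mul_comm]
    | add x y hx hy => simp only [map_add, add_smul, Finset.sum_add_distrib, hx, hy]
  -- On the two sides the coefficients apply ε(·1₂) and ε(1'₁·) to the factors of Δ(h) in opposite
  -- orders. The two weak counit axioms make both equal to ε(1'₁h1₂).
  rw [h₁, h₂]
  simp only [← WeakBialgebra.counit_mul_mul', ← WeakBialgebra.counit_mul_mul]

end WeakBialgebra

end Identities

/-! ### Convolution of linear maps -/

section Convolution

variable {R C A D : Type*} [CommRing R] [AddCommGroup C] [Module R C] [Coalgebra R C]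
  [Ring A] [Algebra R A] [Ring D] [Algebra R D]

lemma toConv_comp_mul_toConv_comp (φ : A →ₗ[R] D) (hφ : ∀ x y, φ (x * y) = φ x * φ y)
    (f g : C →ₗ[R] A) : toConv (φ ∘ₗ f) * toConv (φ ∘ₗ g) =
      toConv (φ ∘ₗ (toConv f * toConv g).ofConv) := by
  ext c
  simp [(ℛ R c).convMul_apply, hφ]

lemma toConv_mulLeft_comp_mul (a : A) (f g : C →ₗ[R] A) :
    toConv (LinearMap.mulLeft R a ∘ₗ f) * toConv g =
      toConv (LinearMap.mulLeft R a ∘ₗ (toConv f * toConv g).ofConv) := by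
  ext c
  simp [(ℛ R c).convMul_apply, mul_assoc]

lemma toConv_mul_mulRight_comp (a : A) (f g : C →ₗ[R] A) :
    toConv f * toConv (LinearMap.mulRight R a ∘ₗ g) =
      toConv (LinearMap.mulRight R a ∘ₗ (toConv f * toConv g).ofConv) := by
  ext c
  simp [(ℛ R c).convMul_apply, mul_assoc]

lemma toConv_mul_mulLeft_comp (a : A) (f g : C →ₗ[R] A) :
    toConv f * toConv (LinearMap.mulLeft R a ∘ₗ g) =
      toConv (LinearMap.mulRight R a ∘ₗ f) * toConv g := by
  ext c
  simp [(ℛ R c).convMul_apply, mul_assoc]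

/-- The coalgebra map `id ⊗ ε : C ⊗ C → C`. -/
noncomputable def projLeft (R C : Type*) [CommRing R] [AddCommGroup C] [Module R C]
    [Coalgebra R C] : C ⊗[R] C →ₗc[R] C :=
  (Coalgebra.TensorProduct.rid R R C).toCoalgHom.comp
    (Coalgebra.TensorProduct.map (CoalgHom.id R C) (counitCoalgHom R C))

/-- The coalgebra map `ε ⊗ id : C ⊗ C → C`. -/
noncomputable def projRight (R C : Type*) [CommRing R] [AddCommGroup C] [Module R C]
    [Coalgebra R C] : C ⊗[R] C →ₗc[R] C :=
  (Coalgebra.TensorProduct.lid R C).toCoalgHom.comp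
    (Coalgebra.TensorProduct.map (counitCoalgHom R C) (CoalgHom.id R C))

@[simp] lemma projLeft_tmul (x y : C) :
    projLeft R C (x ⊗ₜ y) = counit (R := R) y • x := rfl

@[simp] lemma projRight_tmul (x y : C) :
    projRight R C (x ⊗ₜ y) = counit (R := R) x • y := rfl

/-- The second factor depends only on the left leg, so counitality removes the splitting of y and
only x is comultiplied: F(x₁ ⊗ y)f(x₂). This and its mirror image reduce the convolutions on `H ⊗ H`
in `antipode_mul` to sums over one coproduct. -/
lemma convMul_projLeft_tmul (F : C ⊗[R] C →ₗ[R] A) (f : C →ₗ[R] A) (x y : C) :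
    (toConv F * toConv (f ∘ₗ (projLeft R C).toLinearMap)) (x ⊗ₜ y) =
      LinearMap.mul' R A (TensorProduct.map (F ∘ₗ (TensorProduct.mk R C C).flip y) f
        (comul (R := R) x)) := by
  rw [LinearMap.convMul_apply, comul_tmul]
  conv_lhs => rw [← (ℛ R x).eq, ← (ℛ R y).eq]
  conv_rhs => rw [← (ℛ R x).eq]
  simp only [sum_tmul, tmul_sum, map_sum]
  rw [Finset.sum_comm]
  refine Finset.sum_congr rfl fun i _ => ?_
  have hy := congrArg (fun z => F ((ℛ R x).left i ⊗ₜ z) * f ((ℛ R x).right i))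
    (sum_tmul_counit_eq (ℛ R y) |> congrArg (TensorProduct.rid R C))
  simp only [map_sum, tmul_sum, TensorProduct.rid_tmul, one_smul, tmul_smul, map_smul,
    Finset.sum_mul, smul_mul_assoc] at hy
  simp [hy]

lemma projRight_convMul_tmul (F : C ⊗[R] C →ₗ[R] A) (f : C →ₗ[R] A) (x y : C) :
    (toConv (f ∘ₗ (projRight R C).toLinearMap) * toConv F) (x ⊗ₜ y) =
      LinearMap.mul' R A (TensorProduct.map f (F ∘ₗ TensorProduct.mk R C C x)
        (comul (R := R) y)) := by
  rw [LinearMap.convMul_apply, comul_tmul]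
  conv_lhs => rw [← (ℛ R x).eq, ← (ℛ R y).eq]
  conv_rhs => rw [← (ℛ R y).eq]
  simp only [sum_tmul, tmul_sum, map_sum]
  refine Finset.sum_congr rfl fun i _ => ?_
  have hx := congrArg (fun z => f ((ℛ R y).left i) * F (z ⊗ₜ (ℛ R y).right i))
    (sum_counit_smul (ℛ R x))
  simp only [map_sum, sum_tmul, ← smul_tmul', map_smul, Finset.mul_sum, mul_smul_comm] at hx
  simp [hx]

lemma projRight_convMul_projLeft_tmul (f g : C →ₗ[R] A) (x y : C) :
    (toConv (g ∘ₗ (projRight R C).toLinearMap) * toConv (f ∘ₗ (projLeft R C).toLinearMap))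
      (x ⊗ₜ y) = g y * f x := by
  rw [convMul_projLeft_tmul]
  have hx := congrArg (fun z => g y * f z) (sum_counit_smul (ℛ R x))
  conv_lhs => rw [← (ℛ R x).eq]
  simp only [map_sum, map_smul, Finset.mul_sum, mul_smul_comm] at hx
  simpa using hx

lemma projLeft_convMul_projRight_tmul (f g : C →ₗ[R] A) (x y : C) :
    (toConv (f ∘ₗ (projLeft R C).toLinearMap) * toConv (g ∘ₗ (projRight R C).toLinearMap))
      (x ⊗ₜ y) = f x * g y := by
  rw [LinearMap.convMul_apply, comul_tmul]
  have hx := (sum_tmul_counit_eq (ℛ R x) |> congrArg (TensorProduct.rid R C))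
  have hy := sum_counit_smul (ℛ R y)
  simp only [map_sum, TensorProduct.rid_tmul, one_smul] at hx
  conv_rhs => rw [← hx, ← hy]
  conv_lhs => rw [← (ℛ R x).eq, ← (ℛ R y).eq]
  simp only [sum_tmul, tmul_sum, map_sum, Finset.sum_mul_sum]
  rw [Finset.sum_comm]
  simp [smul_smul, mul_comm]

end Convolution

/-! ### The antipode reverses products and coproducts -/

section Antipode

variable {k : Type u} {H : Type w} [Field k] [Ring H] [Algebra k H] [WeakHopfAlgebra k H]

variable (k H) in
/-- The antipode. -/
abbrev antipode : H →ₗ[k] H := WeakHopfAlgebra.antipode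

lemma antipode_convMul_id : toConv (antipode k H) * toConv LinearMap.id =
    toConv (sourceMap k H) := congrArg toConv WeakHopfAlgebra.conv_antipode_id

lemma id_convMul_antipode : toConv LinearMap.id * toConv (antipode k H) =
    toConv (targetMap k H) := congrArg toConv WeakHopfAlgebra.conv_id_antipode

lemma sourceMap_convMul_antipode : toConv (sourceMap k H) * toConv (antipode k H) =
    toConv (antipode k H) := by
  rw [← antipode_convMul_id]
  exact congrArg toConv WeakHopfAlgebra.conv_antipode_id_antipode

lemma antipode_convMul_targetMap : toConv (antipode k H) * toConv (targetMap k H) =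
    toConv (antipode k H) := by
  rw [← id_convMul_antipode, ← mul_assoc, antipode_convMul_id, sourceMap_convMul_antipode]

lemma comul_mul_targetMap (g h : H) : comul (R := k) (g * targetMap k H h) =
    comul g * (targetMap k H h ⊗ₜ[k] (1 : H)) := by
  rw [WeakBialgebra.comul_mul, comul_targetMap, ← mul_assoc, ← WeakBialgebra.comul_mul, mul_one]

lemma comul_sourceMap_mul (g h : H) : comul (R := k) (sourceMap k H g * h) =
    ((1 : H) ⊗ₜ[k] sourceMap k H g) * comul h := by
  rw [WeakBialgebra.comul_mul, comul_sourceMap', mul_assoc, ← WeakBialgebra.comul_mul, one_mul]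

/-- `g₁ε_t(h)S(g₂) = ε_t(gh)`. -/
lemma mul_targetMap_mul_antipode (g h : H) :
    LinearMap.mul' k H (TensorProduct.map (LinearMap.mulRight k (targetMap k H h)) (antipode k H)
      (comul (R := k) g)) = targetMap k H (g * h) := by
  have hconv : ∀ x : H, targetMap k H x = LinearMap.mul' k H
      (TensorProduct.map LinearMap.id (antipode k H) (comul (R := k) x)) :=
    fun x => LinearMap.congr_fun WeakHopfAlgebra.conv_id_antipode.symm x
  rw [← targetMap_mul_targetMap, hconv (g * _), comul_mul_targetMap]
  induction comul (R := k) g with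
  | zero => simp
  | tmul x y => simp
  | add x y hx hy => simp only [map_add, add_mul, hx, hy]

/-- `S(h₁)ε_s(g)h₂ = ε_s(gh)`. -/
lemma antipode_mul_sourceMap_mul (g h : H) :
    LinearMap.mul' k H (TensorProduct.map (antipode k H) (LinearMap.mulLeft k (sourceMap k H g))
      (comul (R := k) h)) = sourceMap k H (g * h) := by
  have hconv : ∀ x : H, sourceMap k H x = LinearMap.mul' k H
      (TensorProduct.map (antipode k H) LinearMap.id (comul (R := k) x)) :=
    fun x => LinearMap.congr_fun WeakHopfAlgebra.conv_antipode_id.symm x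
  rw [← sourceMap_sourceMap_mul, hconv (_ * h), comul_sourceMap_mul]
  induction comul (R := k) h with
  | zero => simp
  | tmul x y => simp
  | add x y hx hy => simp only [map_add, mul_add, hx, hy]

/-- The antipode is antimultiplicative. -/
lemma antipode_mul (g h : H) : antipode k H (g * h) = antipode k H h * antipode k H g := by
  set p := (projLeft k H).toLinearMap
  set q := (projRight k H).toLinearMap
  set S := antipode k H
  set m : H ⊗[k] H →ₗ[k] H := LinearMap.mul' k H
  have comp_m (f g : H →ₗ[k] H) : toConv (f ∘ₗ m) * toConv (g ∘ₗ m) =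
      toConv ((toConv f * toConv g).ofConv ∘ₗ m) := by
    ext x y
    change (toConv (f ∘ₗ m) * toConv (g ∘ₗ m)) (x ⊗ₜ[k] y) = (toConv f * toConv g) (x * y)
    rw [LinearMap.convMul_apply, LinearMap.convMul_apply, WeakBialgebra.comul_mul, comul_tmul]
    rw [← (ℛ k x).eq, ← (ℛ k y).eq]
    simp only [sum_tmul, tmul_sum, Finset.sum_mul_sum, map_sum]
    rw [Finset.sum_comm]
    simp [m]
  have comp_p (f g : H →ₗ[k] H) : toConv (f ∘ₗ p) * toConv (g ∘ₗ p) =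
      toConv ((toConv f * toConv g).ofConv ∘ₗ p) :=
    congrArg toConv (LinearMap.convMul_comp_coalgHom_distrib (toConv f) (toConv g) _).symm
  have comp_q (f g : H →ₗ[k] H) : toConv (f ∘ₗ q) * toConv (g ∘ₗ q) =
      toConv ((toConv f * toConv g).ofConv ∘ₗ q) :=
    congrArg toConv (LinearMap.convMul_comp_coalgHom_distrib (toConv f) (toConv g) _).symm
  -- Both S(xy) and S(y)S(x) will be shown to be generalized convolution inverses of the
  -- multiplication m. Factoring m through the two projections makes its products with b computable.
  have hm : toConv m = toConv (LinearMap.id ∘ₗ p) * toConv (LinearMap.id ∘ₗ q) := by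
    ext x y
    exact (projLeft_convMul_projRight_tmul (R := k) LinearMap.id LinearMap.id x y).symm
  set b := toConv (S ∘ₗ q) * toConv (S ∘ₗ p) with hb
  have ma : toConv m * toConv (S ∘ₗ m) = toConv (targetMap k H ∘ₗ m) := by
    rw [← ofConv_toConv (targetMap k H), ← id_convMul_antipode]
    exact comp_m LinearMap.id S
  have ama : toConv (sourceMap k H ∘ₗ m) * toConv (S ∘ₗ m) = toConv (S ∘ₗ m) := by
    rw [comp_m, sourceMap_convMul_antipode]
  have mb : toConv m * b = toConv (targetMap k H ∘ₗ m) := by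
    rw [hm, hb, mul_assoc, ← mul_assoc (toConv (_ ∘ₗ q)), comp_q, id_convMul_antipode,
      ← mul_assoc]
    ext x y
    change (_ * toConv (S ∘ₗ p)) (x ⊗ₜ[k] y) = targetMap k H (x * y)
    rw [← mul_targetMap_mul_antipode]
    refine (convMul_projLeft_tmul _ _ x y).trans ?_
    congr 3
    ext z
    exact projLeft_convMul_projRight_tmul _ _ z y
  have bm : b * toConv m = toConv (sourceMap k H ∘ₗ m) := by
    rw [hm, hb, mul_assoc, ← mul_assoc (toConv (_ ∘ₗ p)), comp_p, antipode_convMul_id]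
    ext x y
    change (toConv (S ∘ₗ q) * _) (x ⊗ₜ[k] y) = sourceMap k H (x * y)
    rw [← antipode_mul_sourceMap_mul]
    refine (projRight_convMul_tmul _ _ x y).trans ?_
    congr 3
    ext z
    exact projLeft_convMul_projRight_tmul _ _ x z
  have bmb : b * toConv m * b = b := by
    have comm : toConv (sourceMap k H ∘ₗ p) * toConv (targetMap k H ∘ₗ q) =
        toConv (targetMap k H ∘ₗ q) * toConv (sourceMap k H ∘ₗ p) := by
      ext x y
      refine (projLeft_convMul_projRight_tmul _ _ x y).trans
        (Eq.trans ?_ (projRight_convMul_projLeft_tmul _ _ x y).symm)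
      exact (targetMap_mul_sourceMap y x).symm
    calc b * toConv m * b = toConv (S ∘ₗ q) * ((toConv (S ∘ₗ p) * toConv (LinearMap.id ∘ₗ p)) *
          (toConv (LinearMap.id ∘ₗ q) * toConv (S ∘ₗ q))) * toConv (S ∘ₗ p) := by
          rw [hm, hb]; simp only [mul_assoc]
      _ = (toConv (S ∘ₗ q) * toConv (targetMap k H ∘ₗ q)) *
          (toConv (sourceMap k H ∘ₗ p) * toConv (S ∘ₗ p)) := by
          rw [comp_p, comp_q, antipode_convMul_id, id_convMul_antipode, comm]
          simp only [mul_assoc]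
      _ = b := by rw [comp_p, comp_q, antipode_convMul_targetMap, sourceMap_convMul_antipode]
  -- Uniqueness of a generalized inverse: with a = S∘m, the equalities am = bm and ma = mb give a =
  -- ama = bma = bmb = b. Since ε_s and ε_t need not be trivial, the identities ama = a and bmb = b
  -- are needed besides the one-sided products.
  have hab : toConv (S ∘ₗ m) = b := by
    rw [← ama, ← bm, mul_assoc, ma, ← mb, ← mul_assoc, bmb]
  exact (congrArg (fun f => f (g ⊗ₜ[k] h)) hab).trans (projRight_convMul_projLeft_tmul S S g h)

variable (k H) in
/-- The map `h ↦ h ⊗ 1`. -/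
abbrev inclLeft : H →ₗ[k] H ⊗[k] H :=
  (Algebra.TensorProduct.includeLeft : H →ₐ[k] H ⊗[k] H).toLinearMap

variable (k H) in
/-- The map `h ↦ 1 ⊗ h`. -/
abbrev inclRight : H →ₗ[k] H ⊗[k] H :=
  (Algebra.TensorProduct.includeRight : H →ₐ[k] H ⊗[k] H).toLinearMap

lemma inclLeft_comp_convMul (f g : H →ₗ[k] H) :
    toConv (inclLeft k H ∘ₗ f) * toConv (inclLeft k H ∘ₗ g) =
      toConv (inclLeft k H ∘ₗ (toConv f * toConv g).ofConv) :=
  toConv_comp_mul_toConv_comp _ (by simp) f g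

lemma inclRight_comp_convMul (f g : H →ₗ[k] H) :
    toConv (inclRight k H ∘ₗ f) * toConv (inclRight k H ∘ₗ g) =
      toConv (inclRight k H ∘ₗ (toConv f * toConv g).ofConv) :=
  toConv_comp_mul_toConv_comp _ (by simp) f g

lemma comul_comp_convMul (f g : H →ₗ[k] H) :
    toConv (comul ∘ₗ f) * toConv (comul ∘ₗ g) =
      toConv (comul ∘ₗ (toConv f * toConv g).ofConv) :=
  toConv_comp_mul_toConv_comp _ WeakBialgebra.comul_mul f g

lemma inclLeft_convMul_inclRight (f g : H →ₗ[k] H) :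
    toConv (inclLeft k H ∘ₗ f) * toConv (inclRight k H ∘ₗ g) =
      toConv (TensorProduct.map f g ∘ₗ comul) := by
  ext h
  simp only [LinearMap.convMul_apply, LinearMap.comp_apply]
  induction comul (R := k) h with
  | zero => simp
  | tmul x y => simp
  | add x y hx hy => simp only [map_add, hx, hy]

lemma inclRight_convMul_inclLeft (f g : H →ₗ[k] H) :
    toConv (inclRight k H ∘ₗ g) * toConv (inclLeft k H ∘ₗ f) =
      toConv (TensorProduct.map f g ∘ₗ (TensorProduct.comm k H H).toLinearMap ∘ₗ comul) := by
  ext h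
  simp only [LinearMap.convMul_apply, LinearMap.comp_apply]
  induction comul (R := k) h with
  | zero => simp
  | tmul x y => simp
  | add x y hx hy => simp only [map_add, hx, hy]

lemma toConv_comul : toConv (comul (R := k) (A := H)) =
    toConv (inclLeft k H ∘ₗ LinearMap.id) * toConv (inclRight k H ∘ₗ LinearMap.id) := by
  rw [inclLeft_convMul_inclRight, TensorProduct.map_id, LinearMap.id_comp]

/-- `h₁ ⊗ ε_t(h₂) = Δ(1)(h ⊗ 1)`. -/
lemma inclLeft_convMul_targetMap :
    toConv (inclLeft k H ∘ₗ LinearMap.id) * toConv (inclRight k H ∘ₗ targetMap k H) =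
      toConv (LinearMap.mulLeft k (comul (R := k) (1 : H)) ∘ₗ inclLeft k H ∘ₗ LinearMap.id) := by
  rw [inclLeft_convMul_inclRight]
  ext h
  exact lTensor_targetMap_comul h

/-- `ε_s(h₁) ⊗ h₂ = (1 ⊗ h)Δ(1)`. -/
lemma sourceMap_convMul_inclRight :
    toConv (inclLeft k H ∘ₗ sourceMap k H) * toConv (inclRight k H ∘ₗ LinearMap.id) =
      toConv (LinearMap.mulRight k (comul (R := k) (1 : H)) ∘ₗ inclRight k H ∘ₗ
        LinearMap.id) := by
  rw [inclLeft_convMul_inclRight]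
  ext h
  exact rTensor_sourceMap_comul h

/-- The antipode is anticomultiplicative. -/
lemma comul_antipode (h : H) : comul (R := k) (antipode k H h) =
    TensorProduct.map (antipode k H) (antipode k H) (TensorProduct.comm k H H (comul h)) := by
  set S := antipode k H
  set i := inclLeft k H
  set j := inclRight k H
  set d := comul (R := k) (A := H)
  -- The uniqueness argument of `antipode_mul` again, now for maps from `H` to `H ⊗ H`: Δ∘S and b =
  -- S(h₂) ⊗ S(h₁) are generalized inverses of Δ with the same one-sided products.
  set b := toConv (j ∘ₗ S) * toConv (i ∘ₗ S) with hb
  have da : toConv d * toConv (d ∘ₗ S) = toConv (d ∘ₗ targetMap k H) := by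
    rw [← ofConv_toConv (targetMap k H), ← id_convMul_antipode]
    exact comul_comp_convMul LinearMap.id S
  have ada : toConv (d ∘ₗ sourceMap k H) * toConv (d ∘ₗ S) = toConv (d ∘ₗ S) := by
    rw [comul_comp_convMul, sourceMap_convMul_antipode]
  have db : toConv d * b = toConv (d ∘ₗ targetMap k H) := by
    rw [toConv_comul, hb, mul_assoc, ← mul_assoc (toConv (j ∘ₗ _)), inclRight_comp_convMul,
      id_convMul_antipode, ← mul_assoc, inclLeft_convMul_targetMap, toConv_mulLeft_comp_mul,
      inclLeft_comp_convMul, id_convMul_antipode]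
    ext x
    exact (comul_targetMap x).symm
  have bd : b * toConv d = toConv (d ∘ₗ sourceMap k H) := by
    rw [toConv_comul, hb, mul_assoc, ← mul_assoc (toConv (i ∘ₗ _)), inclLeft_comp_convMul,
      antipode_convMul_id, sourceMap_convMul_inclRight, toConv_mul_mulRight_comp,
      inclRight_comp_convMul, antipode_convMul_id]
    ext x
    exact (comul_sourceMap' x).symm
  have bdb : b * toConv d * b = b := by
    have comm : toConv (i ∘ₗ sourceMap k H) * toConv (j ∘ₗ targetMap k H) =
        toConv (j ∘ₗ targetMap k H) * toConv (i ∘ₗ sourceMap k H) := by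
      rw [inclLeft_convMul_inclRight, inclRight_convMul_inclLeft]
      ext x
      simpa [TensorProduct.map_comm] using map_sourceMap_targetMap_comul (k := k) x
    calc b * toConv d * b = toConv (j ∘ₗ S) * ((toConv (i ∘ₗ S) * toConv (i ∘ₗ LinearMap.id)) *
          (toConv (j ∘ₗ LinearMap.id) * toConv (j ∘ₗ S))) * toConv (i ∘ₗ S) := by
          rw [toConv_comul, hb]; simp only [mul_assoc]; rfl
      _ = (toConv (j ∘ₗ S) * toConv (j ∘ₗ targetMap k H)) *
          (toConv (i ∘ₗ sourceMap k H) * toConv (i ∘ₗ S)) := by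
          rw [inclLeft_comp_convMul, inclRight_comp_convMul, antipode_convMul_id,
            id_convMul_antipode, comm]
          simp only [mul_assoc]
      _ = b := by rw [inclLeft_comp_convMul, inclRight_comp_convMul, antipode_convMul_targetMap,
        sourceMap_convMul_antipode]
  have hab : toConv (d ∘ₗ S) = b := by
    rw [← ada, ← bd, mul_assoc, da, ← db, ← mul_assoc, bdb]
  rw [hb, inclRight_convMul_inclLeft] at hab
  exact congrArg (fun f => f h) hab

/-- `Δ(S(g₁))(g₂ ⊗ 1) = Δ(1)(1 ⊗ S(g))`. -/
lemma comul_antipode_convMul_inclLeft :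
    toConv (comul ∘ₗ antipode k H) * toConv (inclLeft k H ∘ₗ LinearMap.id) =
      toConv (LinearMap.mulLeft k (comul (R := k) (1 : H)) ∘ₗ inclRight k H ∘ₗ
        antipode k H) := by
  -- Since Δ(S(g₁)) absorbs Δ(1), the factor g₂ ⊗ 1 may be replaced by Δ(1)(g₂ ⊗ 1) = g₂ ⊗ ε_t(g₃).
  -- Writing ε_t as id * S then lets Δ(S(g₁))Δ(g₂) combine into Δ(ε_s(g₁)).
  have h₁ : toConv (comul ∘ₗ antipode k H) * toConv (inclLeft k H ∘ₗ LinearMap.id) =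
      toConv (comul ∘ₗ antipode k H) * (toConv (inclLeft k H ∘ₗ LinearMap.id) *
        toConv (inclRight k H ∘ₗ targetMap k H)) := by
    rw [inclLeft_convMul_targetMap, toConv_mul_mulLeft_comp]
    congr 2
    ext x
    change comul (R := k) (antipode k H x) = comul (antipode k H x) * comul 1
    rw [← WeakBialgebra.comul_mul, mul_one]
  have h₂ : comul ∘ₗ sourceMap k H =
      LinearMap.mulLeft k (comul (R := k) (1 : H)) ∘ₗ inclRight k H ∘ₗ sourceMap k H := by
    ext x
    exact comul_sourceMap x
  rw [h₁, ← ofConv_toConv (targetMap k H), ← id_convMul_antipode, ← inclRight_comp_convMul,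
    ← mul_assoc (toConv (inclLeft k H ∘ₗ _)), ← toConv_comul, ← mul_assoc]
  have h₃ := comul_comp_convMul (antipode k H) LinearMap.id
  rw [antipode_convMul_id, LinearMap.comp_id] at h₃
  rw [h₃, ofConv_toConv, h₂, toConv_mulLeft_comp_mul, inclRight_comp_convMul,
    sourceMap_convMul_antipode]

end Antipode

/-! ### Integrals in the dual -/

section Integrals

variable {k : Type u} {H : Type w} [Field k] [Ring H] [Algebra k H]

/-- `∑ ψ(eⱼ)eʲ = ψ` for dual bases `eⱼ`, `eʲ`. -/
lemma sum_apply_smul_coord {ι : Type*} [Fintype ι] (e : Module.Basis ι k H)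
    (ψ : H →ₗ[k] k) : ∑ j, ψ (e j) • e.coord j = ψ := by
  refine e.ext fun i => ?_
  classical
  simp

section Coalgebra

variable [Coalgebra k H] {ι : Type*} [Fintype ι] (e : Module.Basis ι k H)

/-- `Δ(x) = ∑ (eᵃ * eᵇ)(x) eₐ ⊗ e_b` for dual bases `eₐ`, `eᵃ`. -/
lemma comul_eq_sum_coord (x : H) : comul (R := k) x =
    ∑ a, ∑ b, (toConv (e.coord a) * toConv (e.coord b)) x • e a ⊗ₜ[k] e b := by
  have key : ∀ y : H ⊗[k] H, y = ∑ a, ∑ b, LinearMap.mul' k k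
      (TensorProduct.map (e.coord a) (e.coord b) y) • e a ⊗ₜ[k] e b := by
    intro y
    induction y with
    | zero => simp
    | tmul x y =>
      conv_lhs => rw [← e.sum_repr x, ← e.sum_repr y]
      simp only [sum_tmul, tmul_sum, smul_tmul_smul]
      rw [Finset.sum_comm]
      simp
    | add x y hx hy =>
      simp only [map_add, add_smul, Finset.sum_add_distrib]
      rw [← hx, ← hy]
  exact key _

/-- `∑ (eᵃ * eᵇ)(G(eₐ ⊗ e_b)) = ∑ eʲ(G(Δ(eⱼ)))`. -/
lemma sum_coord_convMul_coord (G : H ⊗[k] H →ₗ[k] H) :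
    ∑ a, ∑ b, (toConv (e.coord a) * toConv (e.coord b)) (G (e a ⊗ₜ[k] e b)) =
      ∑ j, e.coord j (G (comul (R := k) (e j))) := by
  have h₁ : ∀ a b, (toConv (e.coord a) * toConv (e.coord b)) (G (e a ⊗ₜ[k] e b)) =
      ∑ j, (toConv (e.coord a) * toConv (e.coord b)) (e j) * e.coord j (G (e a ⊗ₜ[k] e b)) := by
    intro a b
    conv_lhs => rw [← sum_apply_smul_coord e (toConv (e.coord a) * toConv (e.coord b)).ofConv]
    rw [LinearMap.sum_apply]
    simp only [LinearMap.smul_apply, smul_eq_mul]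
  have h₂ : ∀ j, e.coord j (G (comul (R := k) (e j))) =
      ∑ a, ∑ b, (toConv (e.coord a) * toConv (e.coord b)) (e j) *
        e.coord j (G (e a ⊗ₜ[k] e b)) := by
    intro j
    rw [comul_eq_sum_coord e (e j)]
    simp only [map_sum, map_smul, smul_eq_mul]
  simp only [h₁, h₂]
  rw [Finset.sum_comm_cycle]

end Coalgebra

variable [WeakHopfAlgebra k H]

/-- `∑ y₁(eᵃ * ψ)(y₂)S(eₐ) = ε_t(y₁)ψ(y₂)` lies in `H_t`. -/
lemma sum_mul_antipode_mem {ι : Type*} [Fintype ι] (e : Module.Basis ι k H) (ψ : H →ₗ[k] k)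
    (y : H) : ∑ a, TensorProduct.rid k H ((toConv (e.coord a) * toConv ψ).ofConv.lTensor H
      (comul (R := k) y)) * antipode k H (e a) ∈ targetSpace k H := by
  set η := Algebra.linearMap k H
  have hη (χ : H →ₗ[k] k) (x : H ⊗[k] H) : TensorProduct.rid k H (χ.lTensor H x) =
      LinearMap.mul' k H (TensorProduct.map LinearMap.id (η ∘ₗ χ) x) := by
    induction x with
    | zero => simp
    | tmul x y => simp [η, Algebra.smul_def, Algebra.commutes]
    | add x y hx hy => simp only [map_add, hx, hy]
  -- Expanding S in the dual bases identifies the sum with the triple convolution id * S * ψ, in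
  -- which id * S = ε_t.
  have hS : toConv (antipode k H) =
      ∑ a, toConv (LinearMap.mulRight k (antipode k H (e a)) ∘ₗ η ∘ₗ e.coord a) := by
    rw [← toConv_sum]
    congr 1
    ext x
    conv_lhs => rw [← e.sum_repr x]
    simp only [map_sum, map_smul, LinearMap.sum_apply]
    simp [η, Algebra.smul_def]
  have hcomm (c : H) (f : H →ₗ[k] H) : toConv (LinearMap.mulRight k c ∘ₗ f) * toConv (η ∘ₗ ψ) =
      toConv (LinearMap.mulRight k c ∘ₗ (toConv f * toConv (η ∘ₗ ψ)).ofConv) := by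
    ext x
    simp [(ℛ k x).convMul_apply, η, mul_assoc, Algebra.commutes]
  have key : ∑ a, TensorProduct.rid k H ((toConv (e.coord a) * toConv ψ).ofConv.lTensor H
      (comul (R := k) y)) * antipode k H (e a) = (toConv (targetMap k H) * toConv (η ∘ₗ ψ)) y := by
    rw [← id_convMul_antipode, hS, mul_assoc, Finset.sum_mul, Finset.mul_sum]
    simp only [hcomm, toConv_mul_mulRight_comp]
    rw [← toConv_sum, LinearMap.sum_apply]
    refine Finset.sum_congr rfl fun a _ => ?_
    have := toConv_comp_mul_toConv_comp (C := H) η (by simp [η]) (e.coord a) ψ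
    rw [this, hη]
    rfl
  rw [key, LinearMap.convMul_apply]
  induction comul (R := k) y with
  | zero => simp
  | tmul x y =>
    have := Submodule.smul_mem (targetSpace k H) (ψ y) (LinearMap.mem_range_self _ x)
    simpa [η, ← Algebra.commutes, ← Algebra.smul_def] using this
  | add x y hx hy => simpa only [map_add] using add_mem hx hy

/-- `Δ(h)(1 ⊗ S²(g)) = Δ(hS²(g₂))(S(g₁) ⊗ 1)`. -/
lemma comul_mul_antipode_antipode (h g : H) :
    comul (R := k) h * ((1 : H) ⊗ₜ[k] antipode k H (antipode k H g)) =
      TensorProduct.lift ((LinearMap.mul k (H ⊗[k] H)).flip.compl₁₂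
        (inclLeft k H ∘ₗ antipode k H)
        (comul ∘ₗ LinearMap.mulLeft k h ∘ₗ antipode k H ∘ₗ antipode k H)) (comul g) := by
  have h₁ := congrArg (fun f => comul (R := k) h * f (antipode k H g))
    (comul_antipode_convMul_inclLeft (k := k) (H := H))
  simp only [LinearMap.convMul_apply, LinearMap.comp_apply, LinearMap.mulLeft_apply] at h₁
  rw [← mul_assoc, ← WeakBialgebra.comul_mul, mul_one, comul_antipode] at h₁
  refine h₁.symm.trans ?_
  induction comul (R := k) g with
  | zero => simp
  | tmul x y => simp [← mul_assoc, WeakBialgebra.comul_mul]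
  | add x y hx hy => simp only [map_add, mul_add, hx, hy]

/-- The functional `h ↦ ∑ (eʲ * φ)(hS²(eⱼ))`. -/
noncomputable def traceIntegral {ι : Type*} [Fintype ι] (e : Module.Basis ι k H)
    (φ : H →ₗ[k] k) : H →ₗ[k] k :=
  ∑ j, (toConv (e.coord j) * toConv φ).ofConv ∘ₗ
    LinearMap.mulRight k (antipode k H (antipode k H (e j)))

/-- `traceIntegral e φ` is a left integral: `h₁λ(h₂) ∈ H_t`. -/
lemma lTensor_traceIntegral_comul_mem {ι : Type*} [Fintype ι] (e : Module.Basis ι k H)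
    (φ : H →ₗ[k] k) (h : H) :
    TensorProduct.rid k H ((traceIntegral e φ).lTensor H (comul (R := k) h)) ∈
      targetSpace k H := by
  set P : (H →ₗ[k] k) → H ⊗[k] H →ₗ[k] H := fun χ =>
    (TensorProduct.rid k H).toLinearMap ∘ₗ χ.lTensor H with hP
  have P_sum (f : ι → (H →ₗ[k] k)) (x : H ⊗[k] H) : P (∑ j, f j) x = ∑ j, P (f j) x := by
    induction x with
    | zero => simp
    | tmul x y => simp [hP, Finset.sum_smul]
    | add x y hx hy => simp only [map_add, hx, hy, Finset.sum_add_distrib]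
  have P_smul (c : k) (f : H →ₗ[k] k) (x : H ⊗[k] H) : P (c • f) x = c • P f x := by
    induction x with
    | zero => simp
    | tmul x y => simp [hP, smul_smul]
    | add x y hx hy => simp only [map_add, hx, hy, smul_add]
  have P_mulRight (χ : H →ₗ[k] k) (g : H) (x : H ⊗[k] H) :
      P (χ ∘ₗ LinearMap.mulRight k g) x = P χ (x * ((1 : H) ⊗ₜ[k] g)) := by
    induction x with
    | zero => simp
    | tmul x y => simp [hP]
    | add x y hx hy => simp only [map_add, add_mul, hx, hy]
  have P_mul (χ : H →ₗ[k] k) (g : H) (x : H ⊗[k] H) :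
      P χ (x * (g ⊗ₜ[k] (1 : H))) = P χ x * g := by
    induction x with
    | zero => simp
    | tmul x y => simp [hP]
    | add x y hx hy => simp only [map_add, add_mul, hx, hy]
  -- `comul_mul_antipode_antipode` moves S²(eⱼ) inside Δ at the cost of a right factor S in the
  -- first leg. By duality of bases the coproduct of eⱼ becomes the convolution eᵃ * eᵇ. For each b
  -- what remains is the sum in `sum_mul_antipode_mem`, with y = hS²(e_b) and ψ = eᵇ * φ.
  have key : P (traceIntegral e φ) (comul (R := k) h) =
      ∑ b, ∑ a, P (toConv (e.coord a) * (toConv (e.coord b) * toConv φ)).ofConv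
        (comul (R := k) (h * antipode k H (antipode k H (e b)))) * antipode k H (e a) := by
    rw [traceIntegral, P_sum]
    simp only [P_mulRight, comul_mul_antipode_antipode]
    have h₁ : ∀ a b, (toConv (e.coord a) * (toConv (e.coord b) * toConv φ)).ofConv =
        ∑ j, (toConv (e.coord a) * toConv (e.coord b)) (e j) •
          (toConv (e.coord j) * toConv φ).ofConv := by
      intro a b
      rw [← mul_assoc]
      conv_lhs => rw [← toConv_ofConv (toConv (e.coord a) * toConv (e.coord b)),
        ← sum_apply_smul_coord e (toConv (e.coord a) * toConv (e.coord b)).ofConv]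
      simp only [toConv_sum, toConv_smul, Finset.sum_mul, smul_mul_assoc, ofConv_sum, ofConv_smul]
    simp only [h₁, P_sum, P_smul, Finset.sum_mul]
    have h₂ : ∀ j, comul (R := k) (e j) = _ := fun j => comul_eq_sum_coord e (e j)
    simp only [h₂, map_sum, map_smul]
    rw [Finset.sum_comm_cycle]
    refine Finset.sum_congr rfl fun b _ => ?_
    rw [Finset.sum_comm]
    refine Finset.sum_congr rfl fun a _ => Finset.sum_congr rfl fun j _ => ?_
    rw [smul_mul_assoc, ← P_mul]
    rfl
  change P _ _ ∈ _
  rw [key]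
  exact sum_mem fun b _ => sum_mul_antipode_mem e _ _

/-- Antimultiplicativity turns S(eᵢ)S²(eⱼ) into S(S(eⱼ)eᵢ). Dualizing eʲ * eⁱ into a coproduct
leaves the trace of x ↦ hS(ε_s(x)), which equals ε(hS(1₁)1₂) = ε(hε_s(1)) = ε(h). This is the
identity that makes the functionals in `IsWeakGalois.exists_dual_basis` reproduce each a. -/
lemma sum_traceIntegral_coord {ι : Type*} [Fintype ι] (e : Module.Basis ι k H) (h : H) :
    ∑ i, traceIntegral e (e.coord i) (h * antipode k H (e i)) = counit (R := k) h := by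
  obtain ⟨s, hs⟩ := exists_comul_one k (H := H)
  have hsource : ∀ x : H, LinearMap.mul' k H
      (TensorProduct.map (antipode k H) LinearMap.id (comul (R := k) x)) = sourceMap k H x :=
    fun x => LinearMap.congr_fun WeakHopfAlgebra.conv_antipode_id x
  let G : H ⊗[k] H →ₗ[k] H := LinearMap.mulLeft k h ∘ₗ antipode k H ∘ₗ LinearMap.mul' k H ∘ₗ
    TensorProduct.map (antipode k H) LinearMap.id
  have h₁ : ∑ i, traceIntegral e (e.coord i) (h * antipode k H (e i)) =
      ∑ a, ∑ b, (toConv (e.coord a) * toConv (e.coord b)) (G (e a ⊗ₜ[k] e b)) := by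
    rw [Finset.sum_comm]
    refine Finset.sum_congr rfl fun i _ => ?_
    rw [traceIntegral, LinearMap.sum_apply]
    refine Finset.sum_congr rfl fun j _ => ?_
    simp only [G, LinearMap.comp_apply, LinearMap.mulRight_apply, LinearMap.mulLeft_apply,
      TensorProduct.map_tmul, LinearMap.mul'_apply, LinearMap.id_apply, antipode_mul, mul_assoc]
  have h₂ : ∀ j, e.coord j (G (comul (R := k) (e j))) = ∑ p ∈ s,
      counit (R := k) (e j * p.2) * e.coord j (h * antipode k H p.1) := by
    intro j
    simp only [G, LinearMap.comp_apply, hsource, sourceMap_eq_sum s hs, map_sum, map_smul,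
      smul_eq_mul, LinearMap.mulLeft_apply]
  have h₃ : ∀ p : H × H, ∑ j, counit (R := k) (e j * p.2) * e.coord j (h * antipode k H p.1) =
      counit (R := k) (h * antipode k H p.1 * p.2) := by
    intro p
    have := LinearMap.congr_fun (sum_apply_smul_coord e (counit ∘ₗ LinearMap.mulRight k p.2))
      (h * antipode k H p.1)
    simpa only [LinearMap.sum_apply, LinearMap.smul_apply, smul_eq_mul, LinearMap.comp_apply,
      LinearMap.mulRight_apply] using this
  rw [h₁, sum_coord_convMul_coord]
  simp only [h₂]
  rw [Finset.sum_comm]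
  simp only [h₃]
  have := hsource 1
  rw [hs, sourceMap_one] at this
  simp only [map_sum, TensorProduct.map_tmul, LinearMap.mul'_apply, LinearMap.id_apply] at this
  conv_rhs => rw [← mul_one h, ← this, Finset.mul_sum, map_sum]
  simp only [mul_assoc]

end Integrals

/-! ### Integrals in semisimple weak Hopf algebras -/

/-- A semisimple weak bialgebra has a normalized right integral. -/
lemma exists_normalized_integral (k : Type u) (H : Type w) [Field k] [Ring H] [Algebra k H]
    [WeakBialgebra k H] [IsSemisimpleRing H] :
    ∃ t : H, (∀ h, t * h = t * sourceMap k H h) ∧ sourceMap k H t = 1 := by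
  -- The kernel of ε_s is a right ideal because ε_s(xc) = ε_s(ε_s(x)c). A complement exists by
  -- semisimplicity, and t will be the component of 1 in it.
  let J : Submodule Hᵐᵒᵖ H :=
    { carrier := {h | sourceMap k H h = 0}
      add_mem' := fun {a b} ha hb => by
        simp only [Set.mem_ofPred_eq] at ha hb ⊢
        rw [map_add, ha, hb, add_zero]
      zero_mem' := map_zero _
      smul_mem' := fun c x hx => by
        simp only [Set.mem_ofPred_eq] at hx ⊢
        change sourceMap k H (x * c.unop) = 0
        rw [← sourceMap_sourceMap_mul, hx, zero_mul, map_zero] }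
  have : IsSemisimpleModule Hᵐᵒᵖ H := inferInstance
  obtain ⟨K, hK⟩ := exists_isCompl J
  obtain ⟨j, hj, t, ht, h1⟩ :=
    Submodule.mem_sup.1 (hK.sup_eq_top ▸ Submodule.mem_top (x := (1 : H)))
  -- For x in the kernel, tx = x - jx lies both in the kernel and in its complement. Applied to h -
  -- ε_s(h), this is the integral property.
  have hjt : ∀ x : H, sourceMap k H x = 0 → t * x = 0 := by
    intro x hx
    refine Submodule.disjoint_def.1 hK.disjoint _ ?_ (K.smul_mem (MulOpposite.op x) ht)
    have : t * x = x - j * x := by rw [eq_sub_iff_add_eq', ← add_mul, h1, one_mul]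
    change t * x ∈ J
    rw [this]
    exact J.sub_mem hx (J.smul_mem (MulOpposite.op x) hj)
  refine ⟨t, fun h => ?_, ?_⟩
  · rw [← sub_eq_zero, ← mul_sub]
    exact hjt _ (by rw [map_sub, sourceMap_sourceMap, sub_self])
  · have h2 := congrArg (sourceMap k H) h1
    rwa [map_add, show sourceMap k H j = 0 from hj, zero_add, sourceMap_one] at h2

/-! ### Weak comodule algebras -/

section ComoduleAlgebra

variable {k : Type u} {H : Type w} {A : Type v} [Field k] [Ring H] [Algebra k H]
  [WeakHopfAlgebra k H] [Ring A] [Algebra k A]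

variable (k H) in
/-- The map `h ↦ ε(h1₁)1₂`. -/
noncomputable def targetMapOp : H →ₗ[k] H :=
  (TensorProduct.lid k H).toLinearMap ∘ₗ counit.rTensor H ∘ₗ
    LinearMap.mulRight k (comul (R := k) (1 : H)) ∘ₗ (TensorProduct.mk k H H).flip 1

lemma targetMapOp_eq_sum (s : Finset (H × H))
    (hs : comul (R := k) (1 : H) = ∑ i ∈ s, i.1 ⊗ₜ i.2) (h : H) :
    targetMapOp k H h = ∑ i ∈ s, counit (R := k) (h * i.1) • i.2 := by
  simp [targetMapOp, hs, Finset.mul_sum]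

/-- The weak counit axiom gives ε(h1₂) = ε(h1'₁)ε(1'₂1₂). Hence th depends on h only through
`targetMapOp`, for t a right integral; this is how the integral acts on coactions. -/
lemma sourceMap_targetMapOp (h : H) : sourceMap k H (targetMapOp k H h) = sourceMap k H h := by
  obtain ⟨s, hs⟩ := exists_comul_one k (H := H)
  simp only [sourceMap_eq_sum s hs, targetMapOp_eq_sum s hs]
  refine Finset.sum_congr rfl fun i _ => ?_
  rw [counit_mul_sum s hs (g := h) (l := i.2)]
  simp [Finset.sum_mul]

/-- For `x ∈ A ⊗ H_t`: `(id ⊗ Δ)(x) = (1 ⊗ Δ(1))(x ⊗ 1)`. -/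
lemma lTensor_comul_of_mem' {x : A ⊗[k] H}
    (hx : x ∈ LinearMap.range ((targetSpace k H).subtype.lTensor A)) :
    (comul (R := k) (A := H)).lTensor A x =
      ((1 : A) ⊗ₜ[k] comul (1 : H)) * TensorProduct.assoc k A H H (x ⊗ₜ[k] (1 : H)) := by
  obtain ⟨y, rfl⟩ := hx
  induction y with
  | zero => simp
  | tmul a z =>
    obtain ⟨_, h, rfl⟩ := z
    simp [Algebra.TensorProduct.tmul_mul_tmul, comul_targetMap]
  | add x y hx hy => simp only [map_add, add_tmul, mul_add, hx, hy]

variable (k H A) in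
/-- The map `id ⊗ ε ⊗ id`. -/
noncomputable def middleCounit : A ⊗[k] (H ⊗[k] H) →ₗ[k] A ⊗[k] H :=
  ((TensorProduct.lid k H).toLinearMap ∘ₗ counit.rTensor H).lTensor A

lemma middleCounit_assoc_tmul (z : A ⊗[k] H) (h : H) :
    middleCounit k H A (TensorProduct.assoc k A H H (z ⊗ₜ[k] h)) =
      (TensorProduct.rid k A ((counit (R := k) (A := H)).lTensor A z)) ⊗ₜ[k] h := by
  induction z with
  | zero => simp
  | tmul a g => simp [middleCounit, TensorProduct.smul_tmul]
  | add x y hx hy => simp only [map_add, add_tmul, hx, hy]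

lemma middleCounit_one_tmul_comul_mul (y : A ⊗[k] H) :
    middleCounit k H A (((1 : A) ⊗ₜ[k] comul (R := k) (1 : H)) *
      TensorProduct.assoc k A H H (y ⊗ₜ[k] (1 : H))) = (targetMap k H).lTensor A y := by
  induction y with
  | zero => simp
  | tmul a h => simp [middleCounit, targetMap_apply]
  | add x y hx hy => simp only [map_add, add_tmul, mul_add, hx, hy]

lemma middleCounit_mul_one_tmul_comul (y : A ⊗[k] H) :
    middleCounit k H A (TensorProduct.assoc k A H H (y ⊗ₜ[k] (1 : H)) *
      ((1 : A) ⊗ₜ[k] comul (R := k) (1 : H))) = (targetMapOp k H).lTensor A y := by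
  induction y with
  | zero => simp
  | tmul a h => simp [middleCounit, targetMapOp]
  | add x y hx hy => simp only [map_add, add_tmul, add_mul, hx, hy]

variable [WeakComoduleAlgebra k H A]

lemma rho_mul (a b : A) : rho k H A (a * b) = rho k H A a * rho k H A b :=
  WeakComoduleAlgebra.coaction_mul a b

lemma middleCounit_assoc_rho (x : A ⊗[k] H) :
    middleCounit k H A (TensorProduct.assoc k A H H ((rho k H A).rTensor H x)) = x := by
  induction x with
  | zero => simp
  | tmul a h =>
    rw [LinearMap.rTensor_tmul, middleCounit_assoc_tmul, WeakComoduleAlgebra.counit_coaction]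
  | add x y hx hy => simp only [map_add, hx, hy]

/-- `a₀ ⊗ ε_t(a₁) = 1₀a ⊗ 1₁`. -/
lemma lTensor_targetMap_rho (a : A) : (targetMap k H).lTensor A (rho k H A a) =
    rho k H A 1 * (a ⊗ₜ[k] (1 : H)) := by
  have f : ∀ x : A ⊗[k] H, (rho k H A).rTensor H (x * (a ⊗ₜ[k] (1 : H))) =
      (rho k H A).rTensor H x * (rho k H A a ⊗ₜ[k] (1 : H)) := by
    intro x
    induction x with
    | zero => simp
    | tmul b h => simp [rho_mul]
    | add x y hx hy => simp only [map_add, add_mul, hx, hy]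
  -- Apply ρ to the first leg and undo it by the middle counit. In between, coassociativity and 1₀ ⊗
  -- 1₁ ∈ `A ⊗ H_t` replace the coaction on ρ(1) by a factor 1 ⊗ Δ(1), which the counit turns into
  -- ε_t.
  rw [← middleCounit_assoc_rho (rho k H A 1 * (a ⊗ₜ[k] (1 : H))), f, assoc_mul,
    WeakComoduleAlgebra.coassoc, lTensor_comul_of_mem' WeakComoduleAlgebra.coaction_one_mem,
    mul_assoc, ← assoc_mul, Algebra.TensorProduct.tmul_mul_tmul, ← rho_mul, one_mul, one_mul,
    middleCounit_one_tmul_comul_mul]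

/-- `a₀ ⊗ ε(a₁1₁)1₂ = a1₀ ⊗ 1₁`. -/
lemma lTensor_targetMapOp_rho (a : A) : (targetMapOp k H).lTensor A (rho k H A a) =
    (a ⊗ₜ[k] (1 : H)) * rho k H A 1 := by
  have f : ∀ x : A ⊗[k] H, (rho k H A).rTensor H ((a ⊗ₜ[k] (1 : H)) * x) =
      (rho k H A a ⊗ₜ[k] (1 : H)) * (rho k H A).rTensor H x := by
    intro x
    induction x with
    | zero => simp
    | tmul b h => simp [rho_mul]
    | add x y hx hy => simp only [map_add, mul_add, hx, hy]
  rw [← middleCounit_assoc_rho ((a ⊗ₜ[k] (1 : H)) * rho k H A 1), f, assoc_mul,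
    WeakComoduleAlgebra.coassoc, lTensor_comul_of_mem WeakComoduleAlgebra.coaction_one_mem,
    ← mul_assoc, ← assoc_mul, Algebra.TensorProduct.tmul_mul_tmul, ← rho_mul, mul_one, mul_one,
    middleCounit_mul_one_tmul_comul]

/-- As ε_t fixes `H_t` pointwise, ρ(a) equals a₀ ⊗ ε_t(a₁), which is always 1₀a ⊗ 1₁. -/
lemma mem_coinvariants_of_rho_mem {a : A}
    (ha : rho k H A a ∈ LinearMap.range ((targetSpace k H).subtype.lTensor A)) :
    a ∈ coinvariants k H A := by
  change rho k H A a = rho k H A 1 * (a ⊗ₜ[k] (1 : H))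
  rw [← lTensor_targetMap_rho]
  obtain ⟨y, hy⟩ := ha
  rw [← hy, ← LinearMap.comp_apply, ← LinearMap.lTensor_comp]
  congr 2
  ext z
  exact (targetMap_of_mem z.2).symm

/-! ### Coinvariants obtained from integrals -/

section Trace

variable (lam : H →ₗ[k] k)

/-- The map `a ↦ a₀λ(a₁)`. -/
noncomputable def dualAction : A →ₗ[k] A :=
  (TensorProduct.rid k A).toLinearMap ∘ₗ lam.lTensor A ∘ₗ rho k H A

lemma rho_dualAction (a : A) : rho k H A (dualAction lam a) =
    ((TensorProduct.rid k H).toLinearMap ∘ₗ lam.lTensor H ∘ₗ comul).lTensor A (rho k H A a) := by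
  have h₁ : ∀ x : A ⊗[k] H, rho k H A (TensorProduct.rid k A (lam.lTensor A x)) =
      TensorProduct.rid k (A ⊗[k] H) (lam.lTensor (A ⊗[k] H) ((rho k H A).rTensor H x)) := by
    intro x
    induction x with
    | zero => simp
    | tmul a h => simp
    | add x y hx hy => simp only [map_add, hx, hy]
  have h₂ : ∀ y : (A ⊗[k] H) ⊗[k] H, TensorProduct.rid k (A ⊗[k] H) (lam.lTensor (A ⊗[k] H) y) =
      ((TensorProduct.rid k H).toLinearMap ∘ₗ lam.lTensor H).lTensor A
        (TensorProduct.assoc k A H H y) := by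
    intro y
    induction y with
    | zero => simp
    | tmul x h =>
      induction x with
      | zero => simp
      | tmul a g => simp
      | add x y hx hy => simp only [map_add, add_tmul, hx, hy]
    | add x y hx hy => simp only [map_add, hx, hy]
  change rho k H A (TensorProduct.rid k A (lam.lTensor A (rho k H A a))) = _
  rw [h₁, h₂, WeakComoduleAlgebra.coassoc, ← LinearMap.comp_apply, ← LinearMap.lTensor_comp,
    LinearMap.comp_assoc]

lemma dualAction_mem_coinvariants
    (hlam : ∀ h, TensorProduct.rid k H (lam.lTensor H (comul (R := k) h)) ∈ targetSpace k H)
    (a : A) : dualAction lam a ∈ coinvariants k H A := by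
  refine mem_coinvariants_of_rho_mem ?_
  rw [rho_dualAction]
  induction rho k H A a with
  | zero => simp
  | tmul a h => exact ⟨a ⊗ₜ ⟨_, hlam h⟩, by simp⟩
  | add x y hx hy => rw [map_add]; exact add_mem hx hy

lemma dualAction_mul (b : coinvariants k H A) (a : A) :
    dualAction lam ((b : A) * a) = (b : A) * dualAction lam a := by
  have h₁ : ∀ x : A ⊗[k] H, TensorProduct.rid k A (lam.lTensor A (((b : A) ⊗ₜ[k] (1 : H)) * x)) =
      (b : A) * TensorProduct.rid k A (lam.lTensor A x) := by
    intro x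
    induction x with
    | zero => simp
    | tmul a h => simp
    | add x y hx hy => simp only [map_add, mul_add, hx, hy]
  change TensorProduct.rid k A (lam.lTensor A (rho k H A ((b : A) * a))) = _
  rw [rho_mul, rho_of_mem_coinvariants b.2, mul_assoc, ← rho_mul, one_mul, h₁]
  rfl

/-- For a left integral `λ`, the left `B`-linear map `A → B`, `a ↦ a₀λ(a₁)`. -/
noncomputable def traceMap
    (hlam : ∀ h, TensorProduct.rid k H (lam.lTensor H (comul (R := k) h)) ∈ targetSpace k H) :
    A →ₗ[coinvariants k H A] coinvariants k H A where
  toFun a := ⟨dualAction lam a, dualAction_mem_coinvariants lam hlam a⟩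
  map_add' a b := Subtype.ext (map_add _ a b)
  map_smul' b a := Subtype.ext (dualAction_mul lam b a)

end Trace

/-! ### Galois extensions -/

lemma galoisMap_mk_sum {ι : Type*} (s : Finset ι) (x y : ι → A) :
    (galoisMap k H A (QuotientAddGroup.mk (∑ i ∈ s, x i ⊗ₜ[ℤ] y i)) : A ⊗[k] H) =
      ∑ i ∈ s, (x i ⊗ₜ[k] (1 : H)) * rho k H A (y i) := by
  change ((galoisAux k H A (∑ i ∈ s, x i ⊗ₜ[ℤ] y i) : tensorTarget k H A) : A ⊗[k] H) = _
  rw [map_sum, AddSubmonoidClass.coe_finsetSum]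
  rfl

lemma IsWeakGalois.exists_sum (hgal : IsWeakGalois k H A) (w : A ⊗[k] H) :
    ∃ s : Finset (A × A), ∑ p ∈ s, (p.1 ⊗ₜ[k] (1 : H)) * rho k H A p.2 = w * rho k H A 1 := by
  obtain ⟨z, hz⟩ := hgal.2 ⟨w * rho k H A 1, w, rfl⟩
  obtain ⟨z, rfl⟩ := QuotientAddGroup.mk_surjective z
  obtain ⟨s, rfl⟩ := TensorProduct.exists_finset z
  exact ⟨s, by rw [← galoisMap_mk_sum, hz]⟩

variable (k H A) in
/-- The map `x ⊗ h ↦ x₀ ⊗ x₁S(h)`. -/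
noncomputable def rhoAntipode : A ⊗[k] H →ₗ[k] A ⊗[k] H :=
  TensorProduct.lift ((LinearMap.mul k (A ⊗[k] H)).compl₁₂ (rho k H A)
    (TensorProduct.mk k A H 1 ∘ₗ antipode k H))

lemma rhoAntipode_tmul (x : A) (h : H) : rhoAntipode k H A (x ⊗ₜ h) =
    rho k H A x * ((1 : A) ⊗ₜ[k] antipode k H h) := rfl

lemma rhoAntipode_rho (y : A) :
    rhoAntipode k H A (rho k H A y) = rho k H A 1 * (y ⊗ₜ[k] (1 : H)) := by
  have h₁ : ∀ x : A ⊗[k] H, rhoAntipode k H A x =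
      (LinearMap.mul' k H ∘ₗ TensorProduct.map LinearMap.id (antipode k H)).lTensor A
        (TensorProduct.assoc k A H H ((rho k H A).rTensor H x)) := by
    intro x
    induction x with
    | zero => simp
    | tmul x h =>
      rw [rhoAntipode_tmul, LinearMap.rTensor_tmul]
      induction rho k H A x with
      | zero => simp
      | tmul a g => simp
      | add x y hx hy => simp only [map_add, add_mul, add_tmul, hx, hy]
    | add x y hx hy => simp only [map_add, hx, hy]
  have h₂ : LinearMap.mul' k H ∘ₗ TensorProduct.map LinearMap.id (antipode k H) ∘ₗ comul =
      targetMap k H := WeakHopfAlgebra.conv_id_antipode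
  rw [h₁, WeakComoduleAlgebra.coassoc, ← LinearMap.comp_apply, ← LinearMap.lTensor_comp,
    LinearMap.comp_assoc, h₂, lTensor_targetMap_rho]

/-- Rewrites β(x ⊗ y) as x₀y ⊗ x₁. A preimage of 1₀ ⊗ g1₁ under β therefore satisfies ∑ x₀y ⊗ x₁ =
1₀ ⊗ 1₁S(g), the form to which an integral can be applied. -/
lemma rhoAntipode_mul_rho (x y : A) :
    rhoAntipode k H A ((x ⊗ₜ[k] (1 : H)) * rho k H A y) =
      rho k H A x * (y ⊗ₜ[k] (1 : H)) := by
  have h₁ : ∀ w : A ⊗[k] H, rhoAntipode k H A ((x ⊗ₜ[k] (1 : H)) * w) =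
      rho k H A x * rhoAntipode k H A w := by
    intro w
    induction w with
    | zero => simp
    | tmul a h => simp [rhoAntipode_tmul, rho_mul, mul_assoc]
    | add x y hx hy => simp only [map_add, mul_add, hx, hy]
  rw [h₁, rhoAntipode_rho, ← mul_assoc, ← rho_mul, mul_one]

lemma rhoAntipode_one_tmul_mul_rho_one (g : H) :
    rhoAntipode k H A (((1 : A) ⊗ₜ[k] g) * rho k H A 1) =
      rho k H A 1 * ((1 : A) ⊗ₜ[k] antipode k H g) := by
  have h₁ : ∀ w : A ⊗[k] H, rhoAntipode k H A (((1 : A) ⊗ₜ[k] g) * w) =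
      rhoAntipode k H A w * ((1 : A) ⊗ₜ[k] antipode k H g) := by
    intro w
    induction w with
    | zero => simp
    | tmul a h => simp [rhoAntipode_tmul, antipode_mul, mul_assoc]
    | add x y hx hy => simp only [map_add, mul_add, add_mul, hx, hy]
  rw [h₁, rhoAntipode_rho, ← Algebra.TensorProduct.one_def, mul_one]

/-- `∑ (axᵢ)₀λ((axᵢ)₁)yᵢ = a₀λ(a₁S(g))` if `β(∑ xᵢ ⊗ yᵢ) = 1₀ ⊗ g1₁`. -/
lemma sum_dualAction_mul {g : H} {s : Finset (A × A)}
    (hs : ∑ p ∈ s, (p.1 ⊗ₜ[k] (1 : H)) * rho k H A p.2 = ((1 : A) ⊗ₜ[k] g) * rho k H A 1)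
    (lam : H →ₗ[k] k) (a : A) : ∑ p ∈ s, dualAction lam (a * p.1) * p.2 =
      dualAction (lam ∘ₗ LinearMap.mulRight k (antipode k H g)) a := by
  -- Multiplying by ρ(a) on the left turns x₀ ⊗ x₁ into the coaction of ax before λ is applied to
  -- the second leg.
  have h₁ := congrArg (fun w => TensorProduct.rid k A (lam.lTensor A
    (rho k H A a * rhoAntipode k H A w))) hs
  simp only [map_sum, rhoAntipode_mul_rho, rhoAntipode_one_tmul_mul_rho_one, Finset.mul_sum,
    ← mul_assoc, ← rho_mul, mul_one] at h₁
  have h₂ : ∀ (w : A ⊗[k] H) (y : A), TensorProduct.rid k A (lam.lTensor A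
      (w * (y ⊗ₜ[k] (1 : H)))) = TensorProduct.rid k A (lam.lTensor A w) * y := by
    intro w y
    induction w with
    | zero => simp
    | tmul a h => simp
    | add x y hx hy => simp only [map_add, add_mul, hx, hy]
  have h₃ : ∀ w : A ⊗[k] H, TensorProduct.rid k A (lam.lTensor A
      (w * ((1 : A) ⊗ₜ[k] antipode k H g))) = TensorProduct.rid k A
        ((lam ∘ₗ LinearMap.mulRight k (antipode k H g)).lTensor A w) := by
    intro w
    induction w with
    | zero => simp
    | tmul a h => simp
    | add x y hx hy => simp only [map_add, add_mul, hx, hy]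
  simp only [h₂, h₃] at h₁
  exact h₁

/-- A weak Galois extension has a finite dual basis on the left. -/
lemma IsWeakGalois.exists_dual_basis [FiniteDimensional k H] (hgal : IsWeakGalois k H A) :
    ∃ (ι : Type v) (_ : Fintype ι) (f : ι → A →ₗ[coinvariants k H A] coinvariants k H A)
      (y : ι → A), ∀ a, ∑ i, f i a • y i = a := by
  let e := Module.finBasis k H
  choose s hs using fun i => hgal.exists_sum ((1 : A) ⊗ₜ[k] e i)
  -- An index is a basis vector eᵢ with a term x ⊗ y of a preimage of 1₀ ⊗ eᵢ1₁. Its functional is a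
  -- ↦ (ax)₀λᵢ((ax)₁), where λᵢ is the trace integral for φ = eⁱ, and its vector is y.
  refine ⟨Σ i : Fin (Module.finrank k H), s i, inferInstance, fun p =>
    (traceMap _ (lTensor_traceIntegral_comul_mem e (e.coord p.1))).comp
      (LinearMap.toSpanSingleton A A p.2.1.1 |>.restrictScalars _), fun p => p.2.1.2, fun a => ?_⟩
  rw [Fintype.sum_sigma]
  have h₁ : ∀ i : Fin (Module.finrank k H), ∑ p : s i,
      ((traceMap _ (lTensor_traceIntegral_comul_mem e (e.coord i))).comp
      (LinearMap.toSpanSingleton A A p.1.1 |>.restrictScalars (coinvariants k H A))) a • p.1.2 =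
      dualAction (traceIntegral e (e.coord i) ∘ₗ
        LinearMap.mulRight k (antipode k H (e i))) a := by
    intro i
    rw [← sum_dualAction_mul (hs i)]
    exact Finset.sum_coe_sort (s i) fun p =>
      dualAction (traceIntegral e (e.coord i)) (a * p.1) * p.2
  simp only [h₁]
  have h₂ : ∀ w : A ⊗[k] H, ∑ i : Fin (Module.finrank k H), TensorProduct.rid k A
      ((traceIntegral e (e.coord i) ∘ₗ LinearMap.mulRight k
        (antipode k H (e i))).lTensor A w) =
      TensorProduct.rid k A ((counit (R := k) (A := H)).lTensor A w) := by
    intro w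
    induction w with
    | zero => simp
    | tmul a h =>
      rw [LinearMap.lTensor_tmul, TensorProduct.rid_tmul, ← sum_traceIntegral_coord e h,
        Finset.sum_smul]
      rfl
    | add x y hx hy => simp only [map_add, Finset.sum_add_distrib, hx, hy]
  exact (h₂ _).trans (WeakComoduleAlgebra.counit_coaction a)

/-- A weak Galois extension by a semisimple weak Hopf algebra is separable. -/
lemma IsWeakGalois.exists_separability (hgal : IsWeakGalois k H A) [IsSemisimpleRing H] :
    ∃ s : Finset (A × A), ∑ p ∈ s, p.1 * p.2 = 1 ∧ ∀ a : A,
      (QuotientAddGroup.mk (∑ p ∈ s, (a * p.1) ⊗ₜ[ℤ] p.2) :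
        BalancedTensor (coinvariants k H A) A) =
      QuotientAddGroup.mk (∑ p ∈ s, p.1 ⊗ₜ[ℤ] (p.2 * a)) := by
  obtain ⟨t, ht, ht1⟩ := exists_normalized_integral k H
  obtain ⟨s, hs⟩ := hgal.exists_sum ((1 : A) ⊗ₜ[k] t)
  refine ⟨s, ?_, fun a => hgal.1 (Subtype.ext ?_)⟩
  · have h₁ := congrArg (fun w => TensorProduct.rid k A
      ((counit (R := k) (A := H)).lTensor A w)) hs
    have h₂ : ∀ (x : A) (w : A ⊗[k] H), TensorProduct.rid k A ((counit (R := k) (A := H)).lTensor A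
        ((x ⊗ₜ[k] (1 : H)) * w)) =
          x * TensorProduct.rid k A ((counit (R := k) (A := H)).lTensor A w) := by
      intro x w
      induction w with
      | zero => simp
      | tmul a h => simp
      | add x y hx hy => simp only [map_add, mul_add, hx, hy]
    -- By the weak counit axiom ε(tz) = ε(t1₂)ε(1₁z) = ε(ε_s(t)z), and ε_s(t) = 1. Applying id ⊗ ε
    -- to the defining equation of the preimage then gives ∑ xy = 1.
    have h₃ : ∀ z : H, counit (R := k) (t * z) = counit (R := k) z := by
      intro z
      obtain ⟨r, hr⟩ := exists_comul_one k (H := H)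
      rw [counit_mul_sum' r hr]
      conv_rhs => rw [← one_mul z, ← ht1, sourceMap_eq_sum r hr]
      simp [Finset.sum_mul]
    have h₄ : ∀ w : A ⊗[k] H, TensorProduct.rid k A ((counit (R := k) (A := H)).lTensor A
        (((1 : A) ⊗ₜ[k] t) * w)) =
          TensorProduct.rid k A ((counit (R := k) (A := H)).lTensor A w) := by
      intro w
      induction w with
      | zero => simp
      | tmul a h => simp [h₃]
      | add x y hx hy => simp only [map_add, mul_add, hx, hy]
    simpa only [map_sum, h₂, h₄, WeakComoduleAlgebra.counit_coaction] using h₁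
  · have h₅ : ∀ w : A ⊗[k] H, ((1 : A) ⊗ₜ[k] t) * w =
        ((1 : A) ⊗ₜ[k] t) * (targetMapOp k H).lTensor A w := by
      intro w
      induction w with
      | zero => simp
      | tmul a h =>
        rw [LinearMap.lTensor_tmul, Algebra.TensorProduct.tmul_mul_tmul,
          Algebra.TensorProduct.tmul_mul_tmul, ht h, ht (targetMapOp k H h),
          sourceMap_targetMapOp]
      | add x y hx hy => rw [map_add, mul_add, mul_add, hx, hy]
    rw [galoisMap_mk_sum, galoisMap_mk_sum]
    have h₆ : ∀ p : A × A, ((a * p.1) ⊗ₜ[k] (1 : H)) * rho k H A p.2 =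
        (a ⊗ₜ[k] (1 : H)) * ((p.1 ⊗ₜ[k] (1 : H)) * rho k H A p.2) := by
      intro p
      rw [← mul_assoc, Algebra.TensorProduct.tmul_mul_tmul, one_mul]
    simp only [h₆, rho_mul, ← mul_assoc _ _ (rho k H A a)]
    rw [← Finset.mul_sum, ← Finset.sum_mul, hs, mul_assoc _ (rho k H A 1), ← rho_mul, one_mul,
      h₅ (rho k H A a), lTensor_targetMapOp_rho, ← mul_assoc, ← mul_assoc]
    simp

end ComoduleAlgebra

open CategoryTheory

/-! ### Projective dimension -/

section Dimension

variable {R : Type u} [Ring R]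

lemma shortExact_of_linearMap {X Y Z : Type v} [AddCommGroup X] [AddCommGroup Y] [AddCommGroup Z]
    [Module R X] [Module R Y] [Module R Z] (f : X →ₗ[R] Y) (g : Y →ₗ[R] Z)
    (hf : Function.Injective f) (hfg : Function.Exact f g) (hg : Function.Surjective g) :
    (ShortComplex.mk (ModuleCat.ofHom f) (ModuleCat.ofHom g)
      (ModuleCat.hom_ext hfg.linearMap_comp_eq_zero)).ShortExact where
  exact := (ShortComplex.ShortExact.moduleCat_exact_iff_function_exact _).2 hfg
  mono_f := (ModuleCat.mono_iff_injective _).2 hf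
  epi_g := (ModuleCat.epi_iff_surjective _).2 hg

lemma hasProjectiveDimensionLT_zero_iff_subsingleton (M : ModuleCat.{v} R) :
    HasProjectiveDimensionLT M 0 ↔ Subsingleton M := by
  rw [hasProjectiveDimensionLT_zero_iff_isZero, ModuleCat.isZero_iff_subsingleton]

lemma hasProjectiveDimensionLT_one_iff_projective [Small.{v} R] (M : ModuleCat.{v} R) :
    HasProjectiveDimensionLT M 1 ↔ Module.Projective R M := by
  rw [← projective_iff_hasProjectiveDimensionLT_one]
  exact (IsProjective.iff_projective (R := R) M).symm

end Dimension

/-! ### Restriction to a subalgebra -/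

section Restriction

variable {k : Type u} {A : Type v} [Field k] [Ring A] [Algebra k A] (B : Subalgebra k A)

lemma projective_and_finite_of_dual_basis {ι : Type v} [Fintype ι] (f : ι → A →ₗ[B] B)
    (y : ι → A) (h : ∀ a, ∑ i, f i a • y i = a) : Module.Projective B A ∧ Module.Finite B A := by
  classical
  have hsplit : (Fintype.linearCombination B y).comp (LinearMap.pi f) = LinearMap.id := by
    ext a
    simpa [Fintype.linearCombination_apply] using h a
  refine ⟨Module.Projective.of_split _ _ hsplit,
    Module.Finite.of_surjective (Fintype.linearCombination B y) fun a => ⟨LinearMap.pi f a, ?_⟩⟩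
  exact LinearMap.congr_fun hsplit a

/-- Projective `A`-modules are projective over `B` if `A` is. -/
lemma projective_restrict [Module.Projective B A] (N : Type v) [AddCommGroup N] [Module A N]
    [Module.Projective A N] : Module.Projective B N := by
  obtain ⟨s, hs⟩ := Module.projective_def'.1 ‹Module.Projective A N›
  have : Module.Projective B (N →₀ A) := by
    classical exact Module.Projective.of_equiv (finsuppLequivDFinsupp B).symm
  exact Module.Projective.of_split (s.restrictScalars B)
    ((Finsupp.linearCombination A id).restrictScalars B)
    (LinearMap.ext fun x => LinearMap.congr_fun hs x)

/-- If restriction to `B` preserves and reflects projectivity of `A`-modules, then it preserves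
projective dimension. -/
lemma hasProjectiveDimensionLT_restrict_iff
    (h : ∀ (N : Type v) [AddCommGroup N] [Module A N],
      Module.Projective B N ↔ Module.Projective A N) (n : ℕ) (N : ModuleCat.{v} A) :
    HasProjectiveDimensionLT (ModuleCat.of B N) n ↔ HasProjectiveDimensionLT N n := by
  -- The bounds are strict: 0 means the zero module and 1 means projective. Both are base cases,
  -- since the syzygy step compares n + 2 with n + 1 only.
  match n with
  | 0 => rw [hasProjectiveDimensionLT_zero_iff_subsingleton,
      hasProjectiveDimensionLT_zero_iff_subsingleton]
  | 1 =>
    rw [hasProjectiveDimensionLT_one_iff_projective, hasProjectiveDimensionLT_one_iff_projective]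
    exact h N
  | n + 2 =>
    let g : (N →₀ A) →ₗ[A] N := Finsupp.linearCombination A id
    have hg : Function.Surjective g := Finsupp.linearCombination_id_surjective A N
    let j : g.ker →ₗ[A] (N →₀ A) := g.ker.subtype
    have hfg : Function.Exact j g := LinearMap.exact_subtype_ker_map g
    have hA := shortExact_of_linearMap (X := g.ker) j g
      (Submodule.subtype_injective _) hfg hg
    let i : g.ker →ₗ[B] (N →₀ A) := j.restrictScalars B
    have hB := shortExact_of_linearMap (X := g.ker) i (g.restrictScalars B)
      (Submodule.subtype_injective _) hfg hg
    have hP : Module.Projective B (N →₀ A) := (h _).2 inferInstance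
    have hAn := hA.hasProjectiveDimensionLT_X₃_iff n
      ((IsProjective.iff_projective (R := A) (N →₀ A)).1 inferInstance)
    have hBn := hB.hasProjectiveDimensionLT_X₃_iff n
      ((IsProjective.iff_projective (R := B) (N →₀ A)).1 hP)
    exact hBn.trans ((hasProjectiveDimensionLT_restrict_iff h (n + 1)
      (ModuleCat.of A g.ker)).trans hAn.symm)

lemma projectiveDimension_restrict
    (h : ∀ (N : Type v) [AddCommGroup N] [Module A N],
      Module.Projective B N ↔ Module.Projective A N) (N : ModuleCat.{v} A) :
    projectiveDimension (ModuleCat.of B N) = projectiveDimension N := by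
  simp only [projectiveDimension, hasProjectiveDimensionLT_restrict_iff B h]

end Restriction

/-! ### The `A`-module `A ⊗_B M` -/

section Balanced

variable {k : Type u} {A : Type v} [Field k] [Ring A] [Algebra k A] (B : Subalgebra k A)

section Module

variable (M : Type w₁) [AddCommGroup M] [Module B M]

lemma smul_mem_balancedRel (a : A) {x : A ⊗[ℤ] M} (hx : x ∈ balancedRel B M) :
    a • x ∈ balancedRel B M := by
  have : balancedRel B M ≤ (balancedRel B M).comap (DistribSMul.toAddMonoidHom (A ⊗[ℤ] M) a) := by
    refine (AddSubgroup.closure_le _).2 ?_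
    rintro _ ⟨a', b, m, rfl⟩
    refine AddSubgroup.subset_closure ⟨a * a', b, m, ?_⟩
    change a • ((a' * (b : A)) ⊗ₜ[ℤ] m - a' ⊗ₜ[ℤ] (b • m)) = _
    rw [smul_sub, smul_tmul', smul_tmul', smul_eq_mul, smul_eq_mul, mul_assoc]
  exact this hx

instance : SMul A (BalancedTensor B M) where
  smul a := QuotientAddGroup.map (balancedRel B M) (balancedRel B M)
    (DistribSMul.toAddMonoidHom (A ⊗[ℤ] M) a)
    fun _ hx => smul_mem_balancedRel B M a hx

instance : Module A (BalancedTensor B M) :=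
  Function.Surjective.module A (QuotientAddGroup.mk' (balancedRel B M))
    (QuotientAddGroup.mk'_surjective _) fun _ _ => rfl

end Module

variable {M : Type w₁} [AddCommGroup M] [Module B M] {N : Type w₂} [AddCommGroup N]

/-- The element `a ⊗ m` of `A ⊗_B M`. -/
def balancedTmul (a : A) (m : M) : BalancedTensor B M := QuotientAddGroup.mk (a ⊗ₜ[ℤ] m)

lemma smul_balancedTmul (a a' : A) (m : M) :
    a • balancedTmul B a' m = balancedTmul B (a * a') m := rfl

lemma balancedTmul_add (a : A) (m m' : M) :
    balancedTmul B a (m + m') = balancedTmul B a m + balancedTmul B a m' :=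
  congrArg QuotientAddGroup.mk (tmul_add a m m')

lemma balancedTmul_smul (a : A) (b : B) (m : M) :
    balancedTmul B a (b • m) = balancedTmul B (a * (b : A)) m := by
  refine Eq.symm (sub_eq_zero.1 ?_)
  exact (QuotientAddGroup.eq_zero_iff _).2 (AddSubgroup.subset_closure ⟨a, b, m, rfl⟩)

@[elab_as_elim]
lemma balancedTensor_induction {P : BalancedTensor B M → Prop} (z : BalancedTensor B M)
    (zero : P 0) (tmul : ∀ a m, P (balancedTmul B a m)) (add : ∀ x y, P x → P y → P (x + y)) :
    P z := by
  obtain ⟨z, rfl⟩ := QuotientAddGroup.mk_surjective z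
  induction z with
  | zero => exact zero
  | tmul a m => exact tmul a m
  | add x y hx hy => exact add _ _ hx hy

/-- The map `M → A ⊗_B M`, `m ↦ 1 ⊗ m`. -/
def balancedUnit : M →ₗ[B] BalancedTensor B M where
  toFun := balancedTmul B 1
  map_add' := balancedTmul_add B 1
  map_smul' b m := by
    rw [balancedTmul_smul]
    change _ = (b : A) • balancedTmul B 1 m
    rw [smul_balancedTmul, one_mul, mul_one]

/-- The map `A ⊗_B M → N`, `a ⊗ m ↦ a f(m)`, for a `B`-linear map `f : M → N` to an
`A`-module. -/
def balancedLift [Module A N] (f : M →ₗ[B] N) : BalancedTensor B M →ₗ[A] N where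
  toFun := QuotientAddGroup.lift (balancedRel B M)
    (TensorProduct.liftAddHom ((smulAddHom A N).flip.comp f.toAddMonoidHom).flip
      (biadditive_zsmul _)) <| by
    refine (AddSubgroup.closure_le _).2 ?_
    rintro _ ⟨a, b, m, rfl⟩
    rw [SetLike.mem_coe, AddMonoidHom.mem_ker, map_sub, sub_eq_zero]
    change (a * (b : A)) • f m = a • f (b • m)
    rw [map_smul, mul_smul]
    rfl
  map_add' := map_add _
  map_smul' a z := by
    refine balancedTensor_induction B z ?_ (fun a' m => mul_smul a a' (f m)) fun x y hx hy => ?_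
    · rw [smul_zero, map_zero, smul_zero]
    · rw [smul_add, map_add, hx, hy, map_add, smul_add]

lemma balancedLift_tmul [Module A N] (f : M →ₗ[B] N) (a : A) (m : M) :
    balancedLift B f (balancedTmul B a m) = a • f m := rfl

variable [Module B N]

lemma balancedMap_tmul (f : M →ₗ[B] N) (a : A) (m : M) :
    balancedMap B f (balancedTmul B a m) = balancedTmul B a (f m) := rfl

/-- `balancedMap` as an `A`-linear map. -/
def balancedMapₗ (f : M →ₗ[B] N) : BalancedTensor B M →ₗ[A] BalancedTensor B N where
  __ := balancedMap B f
  map_smul' a z := by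
    refine balancedTensor_induction B z ?_ (fun a' m => rfl) fun x y hx hy => ?_
    · simp
    · change balancedMap B f (a • (x + y)) = a • balancedMap B f (x + y)
      rw [smul_add, map_add, map_add, smul_add]
      exact congrArg₂ (· + ·) hx hy

lemma balancedMap_surjective {f : M →ₗ[B] N} (hf : Function.Surjective f) :
    Function.Surjective (balancedMap B f) := by
  intro z
  refine balancedTensor_induction B z ⟨0, map_zero _⟩ (fun a n => ?_) ?_
  · obtain ⟨m, rfl⟩ := hf n
    exact ⟨balancedTmul B a m, rfl⟩
  · rintro _ _ ⟨x, rfl⟩ ⟨y, rfl⟩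
    exact ⟨x + y, map_add _ x y⟩

lemma finite_balancedTensor [Module.Finite B M] : Module.Finite A (BalancedTensor B M) := by
  obtain ⟨s, hs⟩ := Module.Finite.fg_top (R := B) (M := M)
  classical
  refine ⟨⟨s.image (balancedUnit B), ?_⟩⟩
  rw [Finset.coe_image, eq_top_iff]
  have hmem : ∀ m : M, balancedUnit B m ∈
      Submodule.span A ((balancedUnit B : M →ₗ[B] BalancedTensor B M) '' s) := by
    intro m
    have hm : m ∈ Submodule.span B (s : Set M) := hs ▸ Submodule.mem_top
    induction hm using Submodule.span_induction with
    | mem x hx => exact Submodule.subset_span ⟨x, hx, rfl⟩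
    | zero => rw [map_zero]; exact zero_mem _
    | add x y _ _ hx hy => rw [map_add]; exact add_mem hx hy
    | smul b x _ hx => rw [map_smul]; exact Submodule.smul_mem _ (b : A) hx
  intro z _
  refine balancedTensor_induction B z (zero_mem _) (fun a m => ?_) fun x y => add_mem
  have := Submodule.smul_mem _ a (hmem m)
  rwa [show a • balancedUnit B m = balancedTmul B a m from
    (smul_balancedTmul B a 1 m).trans (by rw [mul_one])] at this

end Balanced

/-! ### Faithfully flat induction and separability -/

section Flat

variable {k : Type u} {A : Type v} [Field k] [Ring A] [Algebra k A] {B : Subalgebra k A}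
  {M N : Type v} [AddCommGroup M] [Module B M] [AddCommGroup N] [Module B N]

/-- Induction is left adjoint to restriction, which preserves surjections; the lifting problem is
solved over `B` and extended by `balancedLift`. -/
lemma projective_balancedTensor [Module.Projective B M] :
    Module.Projective A (BalancedTensor B M) := by
  refine Module.Projective.of_lifting_property fun {X Y} _ _ _ _ f g hf => ?_
  obtain ⟨h, hh⟩ := Module.projective_lifting_property (f.restrictScalars B)
    ((g.restrictScalars B).comp (balancedUnit B : M →ₗ[B] BalancedTensor B M)) hf
  refine ⟨balancedLift B h, LinearMap.ext fun z => ?_⟩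
  refine balancedTensor_induction B z (by simp) (fun a m => ?_) fun x y hx hy => ?_
  · have := LinearMap.congr_fun hh m
    change f (h m) = g (balancedUnit B m) at this
    rw [LinearMap.comp_apply, balancedLift_tmul, map_smul, this, ← map_smul]
    exact congrArg g ((smul_balancedTmul B a 1 m).trans (by rw [mul_one]))
  · rw [map_add, hx, hy, map_add]

lemma IsRightFaithfullyFlat.injective_iff (hflat : IsRightFaithfullyFlat B) (f : M →ₗ[B] N) :
    Function.Injective f ↔ Function.Injective (balancedMap B f) := by
  have h := hflat PUnit M N (0 : PUnit.{v + 1} →ₗ[B] M) f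
  have h₁ : Function.Exact (0 : PUnit.{v + 1} →ₗ[B] M) f ↔ Function.Injective f := by
    rw [injective_iff_map_eq_zero]
    exact ⟨fun h m hm => by simpa [eq_comm] using (h m).1 hm,
      fun h m => ⟨fun hm => ⟨0, by simp [h m hm]⟩, by rintro ⟨_, rfl⟩; simp⟩⟩
  have h₀ : ∀ z, balancedMap B (0 : PUnit.{v + 1} →ₗ[B] M) z = 0 := fun z =>
    balancedTensor_induction B z (map_zero _)
      (fun a m => congrArg QuotientAddGroup.mk (tmul_zero M a)) fun x y hx hy => by
        rw [map_add, hx, hy, add_zero]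
  have h₂ : Function.Exact (balancedMap B (0 : PUnit.{v + 1} →ₗ[B] M)) (balancedMap B f) ↔
      Function.Injective (balancedMap B f) := by
    rw [injective_iff_map_eq_zero]
    refine ⟨fun h m hm => ?_, fun h m => ⟨fun hm => ⟨0, by simp [h m hm]⟩, ?_⟩⟩
    · obtain ⟨z, rfl⟩ := (h m).1 hm
      exact h₀ z
    · rintro ⟨z, rfl⟩
      rw [h₀, map_zero]
  rw [← h₁, h, h₂]

/-- After applying `A ⊗_B -` the unit is split by multiplication a ⊗ (a' ⊗ m) ↦ aa' ⊗ m, and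
faithful flatness reflects injectivity. -/
lemma IsRightFaithfullyFlat.balancedUnit_injective (hflat : IsRightFaithfullyFlat B) :
    Function.Injective (balancedUnit B : M →ₗ[B] BalancedTensor B M) := by
  rw [hflat.injective_iff]
  refine Function.LeftInverse.injective (g := balancedLift B (LinearMap.id)) fun z => ?_
  refine balancedTensor_induction B z (by simp) (fun a m => ?_) fun x y hx hy => ?_
  · rw [balancedMap_tmul, balancedLift_tmul]
    exact (smul_balancedTmul B a 1 m).trans (by rw [mul_one])
  · rw [map_add, map_add, hx, hy]

lemma IsRightFaithfullyFlat.shortExact_balancedMap (hflat : IsRightFaithfullyFlat B)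
    {L : Type v} [AddCommGroup L] [Module B L] (f : L →ₗ[B] M) (g : M →ₗ[B] N)
    (hf : Function.Injective f) (hfg : Function.Exact f g) (hg : Function.Surjective g) :
    (ShortComplex.mk (ModuleCat.ofHom (balancedMapₗ B f)) (ModuleCat.ofHom (balancedMapₗ B g))
      (ModuleCat.hom_ext
        ((hflat L M N f g).1 hfg : Function.Exact (balancedMapₗ B f)
          (balancedMapₗ B g)).linearMap_comp_eq_zero)).ShortExact :=
  shortExact_of_linearMap _ _ ((hflat.injective_iff f).1 hf) ((hflat L M N f g).1 hfg)
    (balancedMap_surjective B hg)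

lemma IsRightFaithfullyFlat.hasProjectiveDimensionLE (hflat : IsRightFaithfullyFlat B) (n : ℕ)
    (M : ModuleCat.{v} B) (hM : HasProjectiveDimensionLE M n) :
    HasProjectiveDimensionLE (ModuleCat.of A (BalancedTensor B M)) n := by
  induction n generalizing M with
  | zero =>
    have : Module.Projective B M := (hasProjectiveDimensionLT_one_iff_projective M).1 hM
    exact (hasProjectiveDimensionLT_one_iff_projective _).2 projective_balancedTensor
  | succ n ih =>
    let g : (M →₀ B) →ₗ[B] M := Finsupp.linearCombination B id
    have hg : Function.Surjective g := Finsupp.linearCombination_id_surjective B M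
    let j : g.ker →ₗ[B] (M →₀ B) := g.ker.subtype
    have hfg : Function.Exact j g := LinearMap.exact_subtype_ker_map g
    have hB := shortExact_of_linearMap (X := g.ker) j g
      (Submodule.subtype_injective _) hfg hg
    have hA := hflat.shortExact_balancedMap (L := g.ker) j g
      (Submodule.subtype_injective _) hfg hg
    have hBn := hB.hasProjectiveDimensionLT_X₃_iff n
      ((IsProjective.iff_projective (R := B) (M →₀ B)).1 inferInstance)
    have hAn := hA.hasProjectiveDimensionLT_X₃_iff n
      ((IsProjective.iff_projective (R := A) _).1 projective_balancedTensor)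
    exact hAn.2 (ih (ModuleCat.of B g.ker) (hBn.1 hM))

/-- Modules over a separable extension which are projective over the subalgebra are
projective. -/
lemma projective_of_separability {s : Finset (A × A)} (hs : ∑ p ∈ s, p.1 * p.2 = 1)
    (hcomm : ∀ a : A, (QuotientAddGroup.mk (∑ p ∈ s, (a * p.1) ⊗ₜ[ℤ] p.2) : BalancedTensor B A) =
      QuotientAddGroup.mk (∑ p ∈ s, p.1 ⊗ₜ[ℤ] (p.2 * a)))
    (K : Type v) [AddCommGroup K] [Module A K] [Module.Projective B K] :
    Module.Projective A K := by
  refine Module.Projective.of_lifting_property'' fun f hf => ?_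
  obtain ⟨σ, hσ⟩ := Module.projective_lifting_property (f.restrictScalars B)
    (LinearMap.id : K →ₗ[B] K) hf
  have hσ' : ∀ m, f (σ m) = m := fun m => LinearMap.congr_fun hσ m
  -- For fixed m the assignment x ⊗ y ↦ xσ(ym) is well defined on `A ⊗_B A` because σ is `B`-linear.
  -- Hence `hcomm` can be evaluated on it.
  have hlift : ∀ (m : K) (x y : A × A → A), balancedLift B (σ.comp
      ((LinearMap.toSpanSingleton A K m).restrictScalars B))
        (QuotientAddGroup.mk (∑ p ∈ s, x p ⊗ₜ[ℤ] y p)) = ∑ p ∈ s, x p • σ (y p • m) := by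
    intro m x y
    have : (QuotientAddGroup.mk (∑ p ∈ s, x p ⊗ₜ[ℤ] y p) : BalancedTensor B A) =
      ∑ p ∈ s, balancedTmul B (x p) (y p) := map_sum (QuotientAddGroup.mk' (balancedRel B A)) _ _
    rw [this, map_sum]
    rfl
  -- The `B`-linear section σ is averaged over the separability element. Centrality of the element
  -- makes the average `A`-linear, and ∑ xy = 1 keeps it a section.
  let h : K →ₗ[A] (K →₀ A) :=
    { toFun := fun m => ∑ p ∈ s, p.1 • σ (p.2 • m)
      map_add' := fun m m' => by simp only [smul_add, map_add, Finset.sum_add_distrib]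
      map_smul' := fun a m => by
        have := congrArg (balancedLift B (σ.comp
          ((LinearMap.toSpanSingleton A K m).restrictScalars B))) (hcomm a)
        rw [hlift m (fun p => a * p.1), hlift m (fun p => p.1) (fun p => p.2 * a)] at this
        simp only [mul_smul] at this
        rw [← this, ← Finset.smul_sum]
        rfl }
  refine ⟨h, LinearMap.ext fun m => ?_⟩
  change f (∑ p ∈ s, p.1 • σ (p.2 • m)) = m
  simp only [map_sum, map_smul, hσ', ← mul_smul]
  rw [← Finset.sum_smul, hs, one_smul]

end Flat

/-! ### Finitistic dimension -/

section FinDim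

variable {k : Type u} {A : Type v} [Field k] [Ring A] [Algebra k A] {B : Subalgebra k A}

lemma projectiveDimension_le_finDim {R : Type v} [Ring R] (M : ModuleCat.{v} R)
    (hM : Module.Finite R M) (hpd : projectiveDimension M < ⊤) :
    projectiveDimension M ≤ finDim R :=
  le_iSup₂_of_le M hM (le_iSup_of_le hpd le_rfl)

/-- A finite finitistic dimension is attained. -/
lemma exists_not_hasProjectiveDimensionLT {R : Type v} [Ring R] {n : ℕ} (hn : finDim R = n) :
    ∃ M : ModuleCat.{v} R, Module.Finite R M ∧ projectiveDimension M < ⊤ ∧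
      ¬ HasProjectiveDimensionLT M n := by
  by_contra! hcon
  have hlt : finDim R < n := by
    -- For n = 0 the bound says every module in the supremum has dimension `⊥`, so the supremum is
    -- `⊥`, which is below 0.
    cases n with
    | zero =>
      refine lt_of_le_of_lt (b := ⊥) (iSup₂_le fun M hM => iSup_le fun hpd => ?_) (by decide)
      have := projectiveDimension_lt_iff.2 (hcon M hM hpd)
      rw [le_bot_iff, ← WithBot.lt_zero_iff_eq_bot]
      exact_mod_cast this
    | succ n =>
      refine lt_of_le_of_lt (b := (n : WithBot ℕ∞)) (iSup₂_le fun M hM => iSup_le fun hpd => ?_)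
        (by exact_mod_cast Nat.lt_succ_self n)
      exact (projectiveDimension_le_iff M n).2 (hcon M hM hpd)
  exact hlt.ne hn

lemma finDim_le_of_projective_iff [Module.Finite B A]
    (hproj : ∀ (N : Type v) [AddCommGroup N] [Module A N],
      Module.Projective B N ↔ Module.Projective A N) :
    finDim A ≤ finDim B := by
  refine iSup₂_le fun N hN => iSup_le fun hpd => ?_
  rw [← projectiveDimension_restrict B hproj] at hpd ⊢
  exact projectiveDimension_le_finDim _ (Module.Finite.trans (R := B) A N) hpd

lemma finDim_ge_of_projective_iff [Module.Finite B A]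
    (hproj : ∀ (N : Type v) [AddCommGroup N] [Module A N],
      Module.Projective B N ↔ Module.Projective A N)
    (hflat : IsRightFaithfullyFlat B) (hB : finDim B < ⊤) : finDim B ≤ finDim A := by
  -- The value `⊥` occurs when `B` is the zero ring, since the zero module has dimension `⊥`.
  obtain hbot | ⟨n, hn⟩ : finDim B = ⊥ ∨ ∃ n : ℕ, finDim B = n := by
    generalize finDim B = d at hB
    induction d with
    | bot => exact Or.inl rfl
    | coe d =>
      induction d with
      | top => exact absurd hB (lt_irrefl _)
      | coe n => exact Or.inr ⟨n, rfl⟩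
  · rw [hbot]; exact bot_le
  by_contra! hlt
  obtain ⟨M, hM, hpd, hMn⟩ := exists_not_hasProjectiveDimensionLT hn
  have hMle : HasProjectiveDimensionLE M n := by
    rw [← projectiveDimension_le_iff, ← hn]
    exact projectiveDimension_le_finDim M hM hpd
  let N := ModuleCat.of A (BalancedTensor B M)
  have hNfin : Module.Finite A N := finite_balancedTensor B
  have hNB : Module.Finite B N := Module.Finite.trans (R := B) A N
  have hNle : HasProjectiveDimensionLE N n := hflat.hasProjectiveDimensionLE n M hMle
  have hNn : HasProjectiveDimensionLT (ModuleCat.of B N) n := by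
    rw [hasProjectiveDimensionLT_restrict_iff B hproj, ← projectiveDimension_lt_iff]
    refine lt_of_le_of_lt (projectiveDimension_le_finDim N hNfin ?_) (hn ▸ hlt)
    exact lt_top_iff_ne_top.2 ((projectiveDimension_ne_top_iff N).2 ⟨n, hNle⟩)
  let i : M →ₗ[B] BalancedTensor B M := balancedUnit B
  have hS := shortExact_of_linearMap i i.range.mkQ hflat.balancedUnit_injective
    (LinearMap.exact_map_mkQ_range i) (Submodule.mkQ_surjective _)
  -- The exact sequence gives only pd C ≤ n + 1. Being finite, and C being finitely generated over
  -- `B`, it is bounded by fin.dim `B` = n. This drop by one yields pd M < n below.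
  have hC : HasProjectiveDimensionLE (ModuleCat.of B (BalancedTensor B M ⧸ i.range)) n := by
    have h₂ : HasProjectiveDimensionLE (ModuleCat.of B N) (n + 1) :=
      hasProjectiveDimensionLT_of_ge _ n _ (by lia)
    have := hS.hasProjectiveDimensionLT_X₃ (n + 1) hMle h₂
    rw [← projectiveDimension_le_iff, ← hn]
    refine projectiveDimension_le_finDim _ (Module.Finite.of_surjective i.range.mkQ
      (Submodule.mkQ_surjective _)) ?_
    exact lt_top_iff_ne_top.2 ((projectiveDimension_ne_top_iff _).2 ⟨n + 1, this⟩)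
  exact hMn (hS.hasProjectiveDimensionLT_X₁ n hNn hC)

end FinDim

end WeakHopf

theorem corollary2p4 (k : Type u) [Field k] (H : Type w) [Ring H] [Algebra k H]
    [WeakHopf.WeakHopfAlgebra k H] (hHfin : FiniteDimensional k H) (hHss : IsSemisimpleRing H)
    (A : Type v) [Ring A] [Algebra k A] [WeakHopf.WeakComoduleAlgebra k H A]
    (hBfin : FiniteDimensional k (WeakHopf.coinvariants k H A))
    (hflat : WeakHopf.IsRightFaithfullyFlat (WeakHopf.coinvariants k H A))
    (hgal : WeakHopf.IsWeakGalois k H A)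
    (hconj : WeakHopf.FinitisticDimensionConjecture.{u, v} k) :
    WeakHopf.finDim (WeakHopf.coinvariants k H A) = WeakHopf.finDim A := by
  obtain ⟨ι, _, f, y, hfy⟩ := hgal.exists_dual_basis
  obtain ⟨_, _⟩ := WeakHopf.projective_and_finite_of_dual_basis _ f y hfy
  obtain ⟨s, hs, hcomm⟩ := hgal.exists_separability
  -- Separability gives the forward direction, and projectivity of `A` over `B` the converse.
  have hproj : ∀ (N : Type v) [AddCommGroup N] [Module A N],
      Module.Projective (WeakHopf.coinvariants k H A) N ↔ Module.Projective A N :=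
    fun N _ _ => ⟨fun _ => WeakHopf.projective_of_separability hs hcomm N,
      fun _ => WeakHopf.projective_restrict _ N⟩
  exact le_antisymm (WeakHopf.finDim_ge_of_projective_iff hproj hflat (hconj _ hBfin))
    (WeakHopf.finDim_le_of_projective_iff hproj)
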